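/- **Theorem 5.** *Network.* Let $n\ge 2$ agents communicate over an undirected connected graph with symmetric weighted adjacency matrix $A=[A_{ij}]$, $A_{ij}\ge 0$, and Laplacian $L=\mathrm{diag}(\sum_jA_{ij})-A$. Let $\rho$ be the spectral radius and $\rho_2$ the smallest positive eigenvalue of $L$. *Costs.* Let $f_1,\dots,f_n:\mathbb R^d\to\mathbb R$ be differentiable with $\|\nabla f_i(x)-\nabla f_i(y)\|\le \ell\|x-y\|$ for all $x,y$, where $\ell>0$, let $f=\frac1n\sum_i f_i$, assume $f^\ast=\inf f>-\infty$, and assume the Polyak–Łojasiewicz condition $\frac12\|\nabla f(x)\|^2\ge\nu(f(x)-f^\ast)$ for all $x$, with $\nu>0$. *Compressor.* Let $\mathcal C$ be a randomized map $\mathbb R^d\to\mathbb R^d$ with $\mathbb E_{\mathcal C}\big[\|\mathcal C(x)/r-x\|^2\big]\le(1-\delta)\|x\|^2+C$ for all $x\in\mathbb R^d$, where $r>0$, $C>0$, $\delta\in(0,1]$. Each use of $\mathcal C$ (by an agent at an iteration) draws internal randomness of the same law, independent of the randomness of all earlier iterations. *Algorithm.* Given $x_{i,0}\in\mathbb R^d$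 and $v_{i,0}=\hat x_{i,-1}=y_{i,-1}=0$, for $k=0,1,\dots$ and $i=1,\dots,n$ let $$q_{i,k}=\mathcal C\big((x_{i,k}-\hat x_{i,k-1})/s_k\big),\quad \hat x_{i,k}=\hat x_{i,k-1}+\omega s_kq_{i,k},\quad y_{i,k}=y_{i,k-1}+\omega s_k\sum_{j}L_{ij}q_{j,k},$$ $$x_{i,k+1}=x_{i,k}-\alpha\big(\beta y_{i,k}+\gamma v_{i,k}+\nabla f_i(x_{i,k})\big),\quad v_{i,k+1}=v_{i,k}+\alpha\gamma y_{i,k},$$ and let $\bar x_k=\frac1n\sum_ix_{i,k}$. *Constants.* Put $\varepsilon_9=\omega r\delta/2$, $\varepsilon_{10}=(1-2\varepsilon_9)(1+\varepsilon_9^{-1})$, $\varepsilon_{12}=(\varepsilon_9+2\varepsilon_9^2)/2$, $$\kappa_1=\tfrac4{\rho_2},\quad \kappa_2=\max\Big\{2+2\ell^2,\ \tfrac5{\rho_2},\ \sqrt[3]{\tfrac{16\ell^2(\kappa_1+1)^2}{\rho_2}},\ \tfrac{2\sqrt2\,\ell}{\rho_2}\Big\},\quad \varepsilon_2=\max\Big\{\tfrac{1+\tau_1\rho_2}2,\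 \tfrac{1+\tau_1}2+\tfrac1{2\tau_1\rho_2^2}\Big\},$$ $$\varphi_1=\tfrac12\big(\rho_2\beta-(3\gamma+2+2\ell^2)\big),\quad \varphi_2'=(3+4\varepsilon_{10})\rho^2\beta^2-\rho_2\beta\gamma+(\rho+2)\gamma^2+1+(\tfrac52+4\varepsilon_{10})\ell^2,$$ $$\varphi_3=\tfrac\gamma2-\tfrac5{2\rho_2},\quad \varphi_4'=(2+4\varepsilon_{10})\rho\gamma^2+\tfrac12\rho,\quad \varphi_5=\tfrac18-\tfrac{(\beta+\gamma)^2\ell^2}{\gamma^5\rho_2}-\tfrac{\ell^2}{2\gamma^2\rho_2^2},$$ $$\varphi_6=\tfrac{(\beta+\gamma)\ell^2}{2\gamma^3\rho_2}+\tfrac{\ell^2}{2\gamma^2\rho_2^2}+\tfrac{\ell^2}{2\rho_2^2}+\tfrac{\ell^2}2+\tfrac\ell2,\quad \varphi_7=(\rho+1)\gamma+\tfrac12\rho\beta,$$ $$\varphi_8'=(3+4\varepsilon_{10})\rho^2\beta^2+(\rho-2\rho_2)\beta\gamma+(\rho+2)\gamma^2+1,$$ $$\hat\kappa_0'=\min\Big\{\tfrac{\varphi_1}{\varphi_2'},\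 \tfrac{\varphi_3}{\varphi_4'},\ \tfrac{\varphi_5}{\varphi_6},\ \tfrac{\sqrt{\varphi_7^2+8\varepsilon_{12}\varphi_8'}-\varphi_7}{2\varphi_8'}\Big\},$$ $$\varepsilon_3'=\min\{\varphi_1-\alpha\varphi_2',\ \varphi_3-\alpha\varphi_4'\},\quad \varepsilon_6'=\tfrac1{\varepsilon_2}\min\Big\{\tfrac\nu2,\ \varepsilon_3',\ \tfrac{2\varepsilon_{12}-\alpha\varphi_7-\alpha^2\varphi_8'}\alpha\Big\}.$$ *Parameters.* Let $\tau_1\ge\kappa_1$, $\gamma>\kappa_2$, $\beta=\tau_1\gamma$, $\omega\in(0,1/r]$, $\alpha\in(0,\hat\kappa_0')$, $\varepsilon\in(0,1)$, $s_k=s_0\varepsilon^k$ with $s_0>0$ and $s_0\ge\max_i\|x_{i,0}\|_p$ for some $p\in[1,\infty]$. *Conclusion.* Then $\max\{1-\alpha\varepsilon_6',\varepsilon^2\}\in(0,1)$, the expectations below are finite, and for every $\hat\varepsilon\in(\max\{1-\alpha\varepsilon_6',\varepsilon^2\},1)$, $$\mathbb E_{\mathcal C}\Big[f(\bar x_k)-f^\ast+\frac1n\sum_{i=1}^n\|x_{i,k}-\bar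 x_k\|^2\Big]=\mathcal O(\hat\varepsilon^{\,k})\qquad(k\to\infty).$$ -/

import Mathlib

open MeasureTheory ProbabilityTheory Filter

noncomputable section

namespace UnifiedCompression

/-! ### Communication network -/

/-- The graph underlying a weighted adjacency matrix: `i ≠ j` are joined when the weight of
`(i, j)` or of `(j, i)` is positive. -/
def supportGraph {n : ℕ} (A : Matrix (Fin n) (Fin n) ℝ) : SimpleGraph (Fin n) :=
  SimpleGraph.fromRel (fun i j => 0 < A i j)

/-- `A` is the weighted adjacency matrix of an undirected connected graph. -/
structure IsUndirectedConnected {n : ℕ} (A : Matrix (Fin n) (Fin n) ℝ) : Prop where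
  nonneg : ∀ i j, 0 ≤ A i j
  symm : A.IsSymm
  connected : (supportGraph A).Connected

/-- The Laplacian `L = D - A`, where `D` is the diagonal matrix of the row sums of `A`. -/
def laplacian {n : ℕ} (A : Matrix (Fin n) (Fin n) ℝ) : Matrix (Fin n) (Fin n) ℝ :=
  Matrix.diagonal (fun i => ∑ j, A i j) - A

/-- Spectral radius of a real symmetric matrix, as a real number. -/
def rho {n : ℕ} (M : Matrix (Fin n) (Fin n) ℝ) : ℝ := (spectralRadius ℝ M).toReal

/-- Smallest positive eigenvalue of a real symmetric matrix. -/
def rho2 {n : ℕ} (M : Matrix (Fin n) (Fin n) ℝ) : ℝ := sInf {μ : ℝ | μ ∈ spectrum ℝ M ∧ 0 < μ}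

/-! ### Cost functions -/

/-- The global cost `f = (1/n) ∑ i, f_i`. -/
def globalCost {n d : ℕ} (f : Fin n → EuclideanSpace ℝ (Fin d) → ℝ)
    (x : EuclideanSpace ℝ (Fin d)) : ℝ :=
  (1 / (n : ℝ)) * ∑ i, f i x

/-- The optimal value `f* = inf f`, used only for `f` bounded below. -/
def optValue {n d : ℕ} (f : Fin n → EuclideanSpace ℝ (Fin d) → ℝ) : ℝ :=
  ⨅ x, globalCost f x

/-- `h` is differentiable with an `ℓ`-Lipschitz gradient. -/
def IsSmoothWith {d : ℕ} (ℓ : ℝ) (h : EuclideanSpace ℝ (Fin d) → ℝ) : Prop :=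
  Differentiable ℝ h ∧ ∀ x y, ‖gradient h x - gradient h y‖ ≤ ℓ * ‖x - y‖

/-- Polyak–Łojasiewicz condition with constant `ν` for the global cost. -/
def PLCondition {n d : ℕ} (ν : ℝ) (f : Fin n → EuclideanSpace ℝ (Fin d) → ℝ) : Prop :=
  ∀ x, ν * (globalCost f x - optValue f) ≤ (1 / 2) * ‖gradient (globalCost f) x‖ ^ 2

/-! ### Compressors -/

/-- A randomized compressor `𝒞(ζ, x)`, whose internal randomness `ζ` has law `P`, is globally
bounded with parameters `r`, `δ`, `C`:
`E ‖𝒞(x) / r - x‖² ≤ (1 - δ) ‖x‖² + C` for every `x`. -/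
structure GloballyBounded {d : ℕ} {Z : Type*} [MeasurableSpace Z] (P : Measure Z)
    (𝒞 : Z → EuclideanSpace ℝ (Fin d) → EuclideanSpace ℝ (Fin d)) (r δ C : ℝ) : Prop where
  measurable : Measurable (fun p : Z × EuclideanSpace ℝ (Fin d) => 𝒞 p.1 p.2)
  integrable : ∀ x, Integrable (fun z => ‖r⁻¹ • 𝒞 z x - x‖ ^ 2) P
  bound : ∀ x, ∫ z, ‖r⁻¹ • 𝒞 z x - x‖ ^ 2 ∂P ≤ (1 - δ) * ‖x‖ ^ 2 + C

/-- The internal randomness `ζ i k` of the compression by agent `i` at iteration `k` has law `P`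
and is independent of all the randomness of the iterations before `k`.  Nothing is required of
the joint law of the agents within one iteration. -/
structure IsCompressionNoise {n : ℕ} {Ω Z : Type*} [MeasurableSpace Ω] [MeasurableSpace Z]
    (μ : Measure Ω) (P : Measure Z) (ζ : Fin n → ℕ → Ω → Z) : Prop where
  law : ∀ i k, MeasurePreserving (ζ i k) μ P
  indep : ∀ i k, IndepFun (ζ i k) (fun a => fun (j : Fin n) (t : Fin k) => ζ j t a) μ

/-! ### The algorithm -/

/-- What the agents hold at the start of iteration `k`: `x_{i,k}`, `v_{i,k}`, the surrogate
`x̂_{i,k-1}` and the auxiliary variable `y_{i,k-1}`. -/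
structure State (n d : ℕ) where
  x : Fin n → EuclideanSpace ℝ (Fin d)
  v : Fin n → EuclideanSpace ℝ (Fin d)
  xhat : Fin n → EuclideanSpace ℝ (Fin d)
  y : Fin n → EuclideanSpace ℝ (Fin d)

/-- Initial state: `x_{i,0}` given and `v_{i,0} = x̂_{i,-1} = y_{i,-1} = 0`. -/
def State.init {n d : ℕ} (x0 : Fin n → EuclideanSpace ℝ (Fin d)) : State n d where
  x := x0
  v := fun _ => 0
  xhat := fun _ => 0
  y := fun _ => 0

/-- One iteration with scaling factor `s`, where `c i` is the realization of the compressor used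
by agent `i`. -/
def State.step {n d : ℕ} (f : Fin n → EuclideanSpace ℝ (Fin d) → ℝ)
    (L : Matrix (Fin n) (Fin n) ℝ) (α β γ ω s : ℝ)
    (c : Fin n → EuclideanSpace ℝ (Fin d) → EuclideanSpace ℝ (Fin d))
    (S : State n d) : State n d :=
  let q : Fin n → EuclideanSpace ℝ (Fin d) := fun i => c i (s⁻¹ • (S.x i - S.xhat i))
  let xhat' : Fin n → EuclideanSpace ℝ (Fin d) := fun i => S.xhat i + (ω * s) • q i
  let y' : Fin n → EuclideanSpace ℝ (Fin d) := fun i => S.y i + (ω * s) • ∑ j, L i j • q j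
  { x := fun i => S.x i - α • (β • y' i + γ • S.v i + gradient (f i) (S.x i))
    v := fun i => S.v i + (α * γ) • y' i
    xhat := xhat'
    y := y' }

/-- The state at the start of iteration `k` along the noise realization `z`, with scaling
factors `s`. -/
def run {n d : ℕ} {Z : Type*} (f : Fin n → EuclideanSpace ℝ (Fin d) → ℝ)
    (L : Matrix (Fin n) (Fin n) ℝ) (α β γ ω : ℝ) (s : ℕ → ℝ)
    (𝒞 : Z → EuclideanSpace ℝ (Fin d) → EuclideanSpace ℝ (Fin d))
    (x0 : Fin n → EuclideanSpace ℝ (Fin d)) (z : Fin n → ℕ → Z) : ℕ → State n d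
  | 0 => State.init x0
  | k + 1 => State.step f L α β γ ω (s k) (fun i => 𝒞 (z i k))
      (run f L α β γ ω s 𝒞 x0 z k)

/-- The average of the agents' vectors. -/
def average {n d : ℕ} (x : Fin n → EuclideanSpace ℝ (Fin d)) : EuclideanSpace ℝ (Fin d) :=
  (1 / (n : ℝ)) • ∑ i, x i

/-- Optimality gap at the average plus consensus error,
`f(x̄) - f* + (1/n) ∑ i, ‖x_i - x̄‖²`. -/
def performance {n d : ℕ} (f : Fin n → EuclideanSpace ℝ (Fin d) → ℝ)
    (x : Fin n → EuclideanSpace ℝ (Fin d)) : ℝ :=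
  globalCost f (average x) - optValue f + (1 / (n : ℝ)) * ∑ i, ‖x i - average x‖ ^ 2

/-! ### Constants

Here `ρ` and `ρ₂` stand for the spectral radius and the smallest positive eigenvalue of the
Laplacian. -/

def kappa1 (ρ₂ : ℝ) : ℝ := 4 / ρ₂

def kappa2 (ρ₂ ℓ : ℝ) : ℝ :=
  max (max (2 + 2 * ℓ ^ 2) (5 / ρ₂))
    (max ((16 * ℓ ^ 2 * (kappa1 ρ₂ + 1) ^ 2 / ρ₂) ^ (1 / 3 : ℝ)) (2 * √2 * ℓ / ρ₂))

def eps2 (ρ₂ τ₁ : ℝ) : ℝ :=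
  max ((1 + τ₁ * ρ₂) / 2) ((1 + τ₁) / 2 + 1 / (2 * τ₁ * ρ₂ ^ 2))

def eps9 (ω r δ : ℝ) : ℝ := ω * r * δ / 2

def eps10 (ω r δ : ℝ) : ℝ := (1 - 2 * eps9 ω r δ) * (1 + (eps9 ω r δ)⁻¹)

def eps12 (ω r δ : ℝ) : ℝ := (eps9 ω r δ + 2 * eps9 ω r δ ^ 2) / 2

def phi1 (ρ₂ ℓ β γ : ℝ) : ℝ := (1 / 2) * (ρ₂ * β - (3 * γ + 2 + 2 * ℓ ^ 2))

def phi2' (ρ ρ₂ ℓ β γ ω r δ : ℝ) : ℝ :=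
  (3 + 4 * eps10 ω r δ) * ρ ^ 2 * β ^ 2 - ρ₂ * β * γ + (ρ + 2) * γ ^ 2 + 1
    + (5 / 2 + 4 * eps10 ω r δ) * ℓ ^ 2

def phi3 (ρ₂ γ : ℝ) : ℝ := γ / 2 - (5 / 2) * ρ₂⁻¹

def phi4' (ρ γ ω r δ : ℝ) : ℝ := (2 + 4 * eps10 ω r δ) * ρ * γ ^ 2 + (1 / 2) * ρ

def phi5 (ρ₂ ℓ β γ : ℝ) : ℝ :=
  1 / 8 - (β + γ) ^ 2 / γ ^ 5 * ρ₂⁻¹ * ℓ ^ 2 - 1 / (2 * γ ^ 2) * (ρ₂⁻¹) ^ 2 * ℓ ^ 2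

def phi6 (ρ₂ ℓ β γ : ℝ) : ℝ :=
  (β + γ) / (2 * γ ^ 3) * ρ₂⁻¹ * ℓ ^ 2 + 1 / (2 * γ ^ 2) * (ρ₂⁻¹) ^ 2 * ℓ ^ 2
    + (ρ₂⁻¹) ^ 2 / 2 * ℓ ^ 2 + ℓ ^ 2 / 2 + ℓ / 2

def phi7 (ρ β γ : ℝ) : ℝ := (ρ + 1) * γ + (1 / 2) * ρ * β

def phi8' (ρ ρ₂ β γ ω r δ : ℝ) : ℝ :=
  (3 + 4 * eps10 ω r δ) * ρ ^ 2 * β ^ 2 + (ρ - 2 * ρ₂) * β * γ + (ρ + 2) * γ ^ 2 + 1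

/-- Upper bound for the stepsize `α`. -/
def kappa0' (ρ ρ₂ ℓ β γ ω r δ : ℝ) : ℝ :=
  min (min (phi1 ρ₂ ℓ β γ / phi2' ρ ρ₂ ℓ β γ ω r δ) (phi3 ρ₂ γ / phi4' ρ γ ω r δ))
    (min (phi5 ρ₂ ℓ β γ / phi6 ρ₂ ℓ β γ)
      ((√(phi7 ρ β γ ^ 2 + 8 * eps12 ω r δ * phi8' ρ ρ₂ β γ ω r δ) - phi7 ρ β γ)
        / (2 * phi8' ρ ρ₂ β γ ω r δ)))

def eps3' (ρ ρ₂ ℓ α β γ ω r δ : ℝ) : ℝ :=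
  min (phi1 ρ₂ ℓ β γ - α * phi2' ρ ρ₂ ℓ β γ ω r δ) (phi3 ρ₂ γ - α * phi4' ρ γ ω r δ)

/-- The constant that determines the linear rate `1 - α ε₆'`. -/
def eps6' (ρ ρ₂ ℓ ν α β γ τ₁ ω r δ : ℝ) : ℝ :=
  min (ν / 2) (min (eps3' ρ ρ₂ ℓ α β γ ω r δ)
    ((2 * eps12 ω r δ - α * phi7 ρ β γ - α ^ 2 * phi8' ρ ρ₂ β γ ω r δ) / α)) / eps2 ρ₂ τ₁

end UnifiedCompression

end

/-!
Stack the agents' vectors; let `X` be the centered primal variable, `W` the centered distance of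
the dual variables to their running equilibrium `-γ⁻¹ ∇f_i(x̄)`, and `Q = L⁺`. The Lyapunov
function is `1 / 2 * ‖X‖² + (1 + τ₁) / 2 * ⟪W, Q W⟫ + ⟪X, Q W⟫ + n (f(x̄) - f*)` plus `1 - 2 ε₉`
times the squared compression error `‖x - x̂‖²`. Given the new surrogates `x̂`, the change of the
first three terms over one iteration is a quadratic polynomial in `α`; Young's inequality, the
smoothness of the costs and the Polyak–Łojasiewicz condition show that the Lyapunov function
contracts by `1 - α ε₆'`.

The noise enters only through the update of `x̂`. Since `ω r ≤ 1`, that update is a convex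
combination of doing nothing and a rescaled compression, and the noise is independent of the past,
so in expectation the squared compression error is multiplied by at most `1 - 2 ε₉`, up to an
additive `O(s_k²)`. Altogether `V (k + 1) ≤ q * (V k + M * q ^ k)` with
`q = max (1 - α ε₆') (ε ^ 2)`, whence `V k ≤ (V 0 + k * M) * q ^ k`, and the factor `k` is absorbed
by any rate larger than `q`.
-/

noncomputable section

namespace UnifiedCompression

open scoped InnerProductSpace MatrixOrder

/-! ### Matrices acting on stacked vectors -/

/-- The space of stacked vectors `(x_i)_i` with the Euclidean norm. -/
abbrev Stack (ι E : Type*) : Type _ := PiLp 2 (fun _ : ι => E)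

section Action

open scoped Matrix.Module

variable {ι E : Type*} [Fintype ι] [DecidableEq ι] [NormedAddCommGroup E] [InnerProductSpace ℝ E]

/-- The action of the Kronecker product `M ⊗ I` on stacked vectors. -/
def act (M : Matrix ι ι ℝ) : Stack ι E →ₗ[ℝ] Stack ι E where
  toFun x := WithLp.toLp 2 (M • x.ofLp)
  map_add' x y := congrArg (WithLp.toLp 2) (smul_add M x.ofLp y.ofLp)
  map_smul' c x := by
    ext i
    simp [smul_comm c]

@[simp]
lemma act_apply (M : Matrix ι ι ℝ) (x : Stack ι E) (i : ι) : act M x i = ∑ j, M i j • x j := rfl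

lemma act_one (x : Stack ι E) : act 1 x = x :=
  congrArg (WithLp.toLp 2) (one_smul (Matrix ι ι ℝ) x.ofLp)

lemma act_mul (M N : Matrix ι ι ℝ) (x : Stack ι E) : act (M * N) x = act M (act N x) :=
  congrArg (WithLp.toLp 2) (mul_smul M N x.ofLp)

lemma act_sub (M N : Matrix ι ι ℝ) (x : Stack ι E) : act (M - N) x = act M x - act N x :=
  congrArg (WithLp.toLp 2) (sub_smul M N x.ofLp)

lemma act_smul (c : ℝ) (M : Matrix ι ι ℝ) (x : Stack ι E) : act (c • M) x = c • act M x :=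
  congrArg (WithLp.toLp 2) (smul_assoc c M x.ofLp)

lemma inner_act_transpose (M : Matrix ι ι ℝ) (x y : Stack ι E) :
    ⟪act M.transpose x, y⟫_ℝ = ⟪x, act M y⟫_ℝ := by
  simp only [PiLp.inner_apply, act_apply, Matrix.transpose_apply, sum_inner, inner_sum,
    real_inner_smul_left, real_inner_smul_right]
  exact Finset.sum_comm

lemma inner_act_of_isHermitian {M : Matrix ι ι ℝ} (hM : M.IsHermitian) (x y : Stack ι E) :
    ⟪act M x, y⟫_ℝ = ⟪x, act M y⟫_ℝ := by
  rw [← inner_act_transpose, ← Matrix.conjTranspose_eq_transpose_of_trivial, hM.eq]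

lemma inner_act_self_nonneg {M : Matrix ι ι ℝ} (hM : M.PosSemidef) (x : Stack ι E) :
    0 ≤ ⟪x, act M x⟫_ℝ := by
  obtain ⟨B, rfl⟩ := CStarAlgebra.nonneg_iff_eq_star_mul_self.mp hM.nonneg
  rw [act_mul, Matrix.star_eq_conjTranspose, Matrix.conjTranspose_eq_transpose_of_trivial,
    real_inner_comm, inner_act_transpose]
  exact real_inner_self_nonneg

lemma inner_act_mono {M N : Matrix ι ι ℝ} (h : M ≤ N) (x : Stack ι E) :
    ⟪x, act M x⟫_ℝ ≤ ⟪x, act N x⟫_ℝ := by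
  have := inner_act_self_nonneg (Matrix.le_iff.mp h) x
  rwa [act_sub, inner_sub_right, sub_nonneg] at this

end Action

/-! ### The spectrum of the Laplacian -/

section Spectrum

variable {n : ℕ} {M : Matrix (Fin n) (Fin n) ℝ} {t : ℝ}

lemma norm_le_rho (ht : t ∈ spectrum ℝ M) : ‖t‖ ≤ rho M := by
  obtain ⟨c, hc⟩ := (M.finite_real_spectrum.image fun k : ℝ => ‖k‖₊).bddAbove
  have hfin : spectralRadius ℝ M ≠ ⊤ :=
    ne_top_of_le_ne_top (ENNReal.coe_ne_top (r := c))
      (iSup₂_le fun k hk => ENNReal.coe_le_coe.mpr (hc ⟨k, hk, rfl⟩))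
  have hle : (‖t‖₊ : ENNReal) ≤ spectralRadius ℝ M :=
    le_iSup₂ (f := fun (k : ℝ) (_ : k ∈ spectrum ℝ M) => (‖k‖₊ : ENNReal)) t ht
  simpa [rho] using ENNReal.toReal_mono hfin hle

lemma rho2_le (ht : t ∈ spectrum ℝ M) (h₀ : 0 < t) : rho2 M ≤ t :=
  csInf_le ⟨0, fun _ h => h.2.le⟩ ⟨ht, h₀⟩

lemma rho2_pos (ht : t ∈ spectrum ℝ M) (h₀ : 0 < t) : 0 < rho2 M := by
  have hne : {μ : ℝ | μ ∈ spectrum ℝ M ∧ 0 < μ}.Nonempty := ⟨t, ht, h₀⟩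
  exact (hne.csInf_mem (M.finite_real_spectrum.subset fun _ h => h.1)).2

lemma cfc_mul_cfc (M : Matrix (Fin n) (Fin n) ℝ) (h g : ℝ → ℝ) :
    cfc h M * cfc g M = cfc (fun t => h t * g t) M :=
  (cfc_mul h g M (M.finite_real_spectrum.continuousOn h)
    (M.finite_real_spectrum.continuousOn g)).symm

lemma cfc_mul_self (hM : M.IsHermitian) (h : ℝ → ℝ) :
    cfc h M * M = cfc (fun t => h t * t) M := by
  rw [← cfc_mul_cfc M h fun t => t, cfc_id' ℝ M hM.isSelfAdjoint]

lemma self_mul_cfc (hM : M.IsHermitian) (h : ℝ → ℝ) :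
    M * cfc h M = cfc (fun t => t * h t) M := by
  rw [← cfc_mul_cfc M (fun t => t) h, cfc_id' ℝ M hM.isSelfAdjoint]

lemma cfc_le_cfc {h g : ℝ → ℝ} (hhg : ∀ t ∈ spectrum ℝ M, h t ≤ g t) : cfc h M ≤ cfc g M :=
  cfc_mono hhg (M.finite_real_spectrum.continuousOn h) (M.finite_real_spectrum.continuousOn g)

lemma smul_cfc (M : Matrix (Fin n) (Fin n) ℝ) (c : ℝ) (h : ℝ → ℝ) :
    c • cfc h M = cfc (fun t => c * h t) M :=
  (cfc_const_mul c h M (M.finite_real_spectrum.continuousOn h)).symm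

end Spectrum

section Laplacian

variable {n : ℕ} {A : Matrix (Fin n) (Fin n) ℝ}

lemma laplacian_isHermitian (hA : A.IsSymm) : (laplacian A).IsHermitian := by
  rw [Matrix.IsHermitian, Matrix.conjTranspose_eq_transpose_of_trivial, laplacian,
    Matrix.transpose_sub, Matrix.diagonal_transpose, hA]

lemma laplacian_mulVec (u : Fin n → ℝ) (i : Fin n) :
    (laplacian A).mulVec u i = ∑ j, A i j * (u i - u j) := by
  rw [laplacian, Matrix.sub_mulVec, Pi.sub_apply, Matrix.mulVec_diagonal]
  simp only [Matrix.mulVec, dotProduct, mul_sub, Finset.sum_sub_distrib, Finset.sum_mul]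

lemma laplacian_mulVec_const (c : ℝ) : (laplacian A).mulVec (fun _ => c) = 0 := by
  ext i
  simp [laplacian_mulVec]

lemma two_mul_dotProduct_laplacian_mulVec (hA : A.IsSymm) (u : Fin n → ℝ) :
    2 * (u ⬝ᵥ (laplacian A).mulVec u) = ∑ i, ∑ j, A i j * (u i - u j) ^ 2 := by
  have h : u ⬝ᵥ (laplacian A).mulVec u = ∑ i, ∑ j, A i j * (u i * (u i - u j)) := by
    simp only [dotProduct, laplacian_mulVec, Finset.mul_sum, mul_left_comm]
  have h' : u ⬝ᵥ (laplacian A).mulVec u = ∑ i, ∑ j, A i j * (u j * (u j - u i)) := by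
    rw [h, Finset.sum_comm]
    simp only [hA.apply]
  rw [two_mul]
  nth_rewrite 1 [h]
  rw [h']
  simp only [← Finset.sum_add_distrib]
  exact Finset.sum_congr rfl fun i _ => Finset.sum_congr rfl fun j _ => by ring

lemma laplacian_posSemidef (hA : A.IsSymm) (h₀ : ∀ i j, 0 ≤ A i j) :
    (laplacian A).PosSemidef := by
  refine .of_dotProduct_mulVec_nonneg (laplacian_isHermitian hA) fun u => ?_
  have hsum : 0 ≤ ∑ i, ∑ j, A i j * (u i - u j) ^ 2 :=
    Finset.sum_nonneg fun i _ => Finset.sum_nonneg fun j _ => mul_nonneg (h₀ i j) (sq_nonneg _)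
  rw [star_trivial]
  linarith [two_mul_dotProduct_laplacian_mulVec hA u]

lemma eq_of_laplacian_mulVec_eq_zero (hA : IsUndirectedConnected A) {u : Fin n → ℝ}
    (hu : (laplacian A).mulVec u = 0) (i j : Fin n) : u i = u j := by
  have hnonneg : ∀ i j, 0 ≤ A i j * (u i - u j) ^ 2 := fun i j =>
    mul_nonneg (hA.nonneg i j) (sq_nonneg _)
  have hsum : ∑ i, ∑ j, A i j * (u i - u j) ^ 2 = 0 := by
    rw [← two_mul_dotProduct_laplacian_mulVec hA.symm, hu, dotProduct_zero, mul_zero]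
  have hzero : ∀ i j, A i j * (u i - u j) ^ 2 = 0 := fun i j =>
    (Finset.sum_eq_zero_iff_of_nonneg fun j _ => hnonneg i j).mp
      ((Finset.sum_eq_zero_iff_of_nonneg fun i _ => Finset.sum_nonneg fun j _ => hnonneg i j).mp
        hsum i (Finset.mem_univ i)) j (Finset.mem_univ j)
  have hedge : ∀ {i j}, 0 < A i j → u i = u j := fun {i j} hij =>
    sub_eq_zero.mp (pow_eq_zero_iff two_ne_zero |>.mp
      ((mul_eq_zero.mp (hzero i j)).resolve_left hij.ne'))
  obtain ⟨w⟩ := hA.connected.preconnected i j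
  induction w with
  | nil => rfl
  | cons h _ ih =>
    rw [← ih]
    rcases ((SimpleGraph.fromRel_adj _ _ _).mp h).2 with h | h
    · exact hedge h
    · exact (hedge h).symm

/-- The matrix `1 - 11ᵀ / n` of the orthogonal projection onto the vectors of mean zero. -/
def centering (n : ℕ) : Matrix (Fin n) (Fin n) ℝ :=
  1 - (1 / (n : ℝ)) • Matrix.of (fun _ _ => 1)

lemma centering_isHermitian : (centering n).IsHermitian := by
  ext i j
  simp [centering, Matrix.one_apply, eq_comm]

lemma laplacian_mul_centering : laplacian A * centering n = laplacian A := by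
  have hone : laplacian A * Matrix.of (fun _ _ => 1) = 0 := by
    ext i _
    exact congrFun (laplacian_mulVec_const 1) i
  rw [centering, mul_sub, mul_one, Matrix.mul_smul, hone, smul_zero, sub_zero]

lemma centering_mul_eq_zero (hA : IsUndirectedConnected A) {M : Matrix (Fin n) (Fin n) ℝ}
    (hM : laplacian A * M = 0) : centering n * M = 0 := by
  ext i j
  have hcol : ∀ k, M k j = M i j := fun k =>
    eq_of_laplacian_mulVec_eq_zero hA (u := fun k => M k j)
      (funext fun k => congrFun (congrFun hM k) j) k i
  have hn : (n : ℝ) ≠ 0 := Nat.cast_ne_zero.mpr i.pos.ne'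
  rw [centering, Matrix.sub_mul, Matrix.one_mul, Matrix.smul_mul]
  simp [Matrix.mul_apply, hcol, hn]

/-- The Moore–Penrose inverse of the Laplacian. -/
def laplacianPinv (A : Matrix (Fin n) (Fin n) ℝ) : Matrix (Fin n) (Fin n) ℝ :=
  cfc (fun t : ℝ => t⁻¹) (laplacian A)

lemma laplacianPinv_isHermitian : (laplacianPinv A).IsHermitian :=
  cfc_predicate (R := ℝ) _ (laplacian A)

lemma cfc_inv_mul_eq_centering (hA : IsUndirectedConnected A) :
    cfc (fun t : ℝ => t⁻¹ * t) (laplacian A) = centering n := by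
  have hL : (laplacian A).IsHermitian := laplacian_isHermitian hA.symm
  set K := cfc (fun t : ℝ => t⁻¹ * t) (laplacian A) with hK
  have hLK : laplacian A * K = laplacian A := by
    rw [hK, self_mul_cfc hL]
    simp only [← mul_assoc, mul_inv_mul_cancel]
    exact cfc_id' ℝ _ hL
  have hCK : centering n * K = centering n := by
    have := centering_mul_eq_zero hA (M := 1 - K) (by rw [mul_sub, mul_one, hLK, sub_self])
    rwa [mul_sub, mul_one, sub_eq_zero, eq_comm] at this
  have hKC : K * centering n = K := by
    rw [hK, ← cfc_mul_self hL, mul_assoc, laplacian_mul_centering]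
  have hKh : K.IsHermitian := cfc_predicate (R := ℝ) _ (laplacian A)
  calc K = (K * centering n).conjTranspose := by rw [hKC, hKh.eq]
    _ = centering n := by
      rw [Matrix.conjTranspose_mul, hKh.eq, centering_isHermitian.eq, hCK]

lemma laplacianPinv_mul_laplacian (hA : IsUndirectedConnected A) :
    laplacianPinv A * laplacian A = centering n := by
  rw [laplacianPinv, cfc_mul_self (laplacian_isHermitian hA.symm), cfc_inv_mul_eq_centering hA]

lemma laplacian_mul_laplacianPinv (hA : IsUndirectedConnected A) :
    laplacian A * laplacianPinv A = centering n := by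
  simp only [laplacianPinv, self_mul_cfc (laplacian_isHermitian hA.symm),
    ← cfc_inv_mul_eq_centering hA, mul_comm]

lemma centering_mul_laplacianPinv (hA : IsUndirectedConnected A) :
    centering n * laplacianPinv A = laplacianPinv A := by
  rw [laplacianPinv, ← cfc_inv_mul_eq_centering hA, cfc_mul_cfc]
  exact congrArg (cfc · _) (funext fun t => by simpa using mul_inv_mul_cancel t⁻¹)

lemma centering_mul_centering (hA : IsUndirectedConnected A) :
    centering n * centering n = centering n := by
  nth_rewrite 2 [← laplacianPinv_mul_laplacian hA]
  rw [← mul_assoc, centering_mul_laplacianPinv hA, laplacianPinv_mul_laplacian hA]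

lemma centering_mul_laplacian (hA : IsUndirectedConnected A) :
    centering n * laplacian A = laplacian A := by
  have h := congrArg Matrix.conjTranspose (laplacian_mul_centering (A := A))
  rwa [Matrix.conjTranspose_mul, centering_isHermitian.eq,
    (laplacian_isHermitian hA.symm).eq] at h

lemma laplacian_spectrum_nonneg (hA : IsUndirectedConnected A) {t : ℝ}
    (ht : t ∈ spectrum ℝ (laplacian A)) : 0 ≤ t :=
  spectrum_nonneg_of_nonneg (laplacian_posSemidef hA.symm hA.nonneg).nonneg ht

lemma laplacian_mul_self_le (hA : IsUndirectedConnected A) :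
    laplacian A * laplacian A ≤ rho (laplacian A) • laplacian A := by
  have hL : (laplacian A).IsHermitian := laplacian_isHermitian hA.symm
  rw [← cfc_id' ℝ (laplacian A) hL.isSelfAdjoint, cfc_mul_cfc, smul_cfc,
    cfc_id' ℝ (laplacian A) hL.isSelfAdjoint]
  exact cfc_le_cfc fun t ht => mul_le_mul_of_nonneg_right
    ((Real.le_norm_self t).trans (norm_le_rho ht)) (laplacian_spectrum_nonneg hA ht)

lemma rho2_smul_centering_le (hA : IsUndirectedConnected A) :
    rho2 (laplacian A) • centering n ≤ laplacian A := by
  have hL : (laplacian A).IsHermitian := laplacian_isHermitian hA.symm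
  rw [← cfc_inv_mul_eq_centering hA, smul_cfc]
  conv_rhs => rw [← cfc_id' ℝ (laplacian A) hL.isSelfAdjoint]
  refine cfc_le_cfc fun t ht => ?_
  rcases (laplacian_spectrum_nonneg hA ht).eq_or_lt with rfl | hpos
  · rw [mul_zero, mul_zero]
  · rw [inv_mul_cancel₀ hpos.ne', mul_one]
    exact rho2_le ht hpos

lemma laplacian_ne_zero (hn : 2 ≤ n) (hA : IsUndirectedConnected A) : laplacian A ≠ 0 := by
  intro h₀
  have := eq_of_laplacian_mulVec_eq_zero hA (u := fun i => if i.val = 0 then 1 else 0)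
    (by rw [h₀, Matrix.zero_mulVec]) ⟨0, by omega⟩ ⟨1, by omega⟩
  simp at this

lemma exists_pos_mem_spectrum_laplacian (hn : 2 ≤ n) (hA : IsUndirectedConnected A) :
    ∃ t ∈ spectrum ℝ (laplacian A), 0 < t := by
  have hL := laplacian_isHermitian hA.symm
  obtain ⟨i, hi⟩ := Function.ne_iff.mp
    (hL.eigenvalues_eq_zero_iff.not.mpr (laplacian_ne_zero hn hA))
  have hmem := hL.eigenvalues_mem_spectrum_real i
  exact ⟨_, hmem, (laplacian_spectrum_nonneg hA hmem).lt_of_ne' hi⟩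

lemma rho2_laplacian_pos (hn : 2 ≤ n) (hA : IsUndirectedConnected A) :
    0 < rho2 (laplacian A) := by
  obtain ⟨t, ht, hpos⟩ := exists_pos_mem_spectrum_laplacian hn hA
  exact rho2_pos ht hpos

lemma rho2_le_rho_laplacian (hn : 2 ≤ n) (hA : IsUndirectedConnected A) :
    rho2 (laplacian A) ≤ rho (laplacian A) := by
  obtain ⟨t, ht, hpos⟩ := exists_pos_mem_spectrum_laplacian hn hA
  exact (rho2_le ht hpos).trans ((Real.le_norm_self t).trans (norm_le_rho ht))

end Laplacian

/-! ### Positive semidefinite operators and their pseudo-inverses -/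

/-- `Q` is the Moore–Penrose inverse of the positive semidefinite operator `L`, with `K` the
projection onto their common range, and the nonzero spectrum of `L` lies in `[ρ₂, ρ]`. The two
spectral bounds are stated as `ρ₂ K ≤ L` and `L² ≤ ρ L`. -/
structure IsPseudoInverse {V : Type*} [NormedAddCommGroup V] [InnerProductSpace ℝ V]
    (L K Q : V →ₗ[ℝ] V) (ρ ρ₂ : ℝ) : Prop where
  L_symm : ∀ x y, ⟪L x, y⟫_ℝ = ⟪x, L y⟫_ℝ
  K_symm : ∀ x y, ⟪K x, y⟫_ℝ = ⟪x, K y⟫_ℝ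
  Q_symm : ∀ x y, ⟪Q x, y⟫_ℝ = ⟪x, Q y⟫_ℝ
  Q_L : ∀ x, Q (L x) = K x
  L_Q : ∀ x, L (Q x) = K x
  K_L : ∀ x, K (L x) = L x
  K_Q : ∀ x, K (Q x) = Q x
  ρ₂_pos : 0 < ρ₂
  ρ₂_le_ρ : ρ₂ ≤ ρ
  norm_L_sq_le : ∀ x, ‖L x‖ ^ 2 ≤ ρ * ⟪x, L x⟫_ℝ
  le_inner_L : ∀ x, ρ₂ * ‖K x‖ ^ 2 ≤ ⟪x, L x⟫_ℝ

namespace IsPseudoInverse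

variable {V : Type*} [NormedAddCommGroup V] [InnerProductSpace ℝ V] {L K Q : V →ₗ[ℝ] V} {ρ ρ₂ : ℝ}

lemma ρ_pos (h : IsPseudoInverse L K Q ρ ρ₂) : 0 < ρ := h.ρ₂_pos.trans_le h.ρ₂_le_ρ

lemma K_K (h : IsPseudoInverse L K Q ρ ρ₂) (x : V) : K (K x) = K x := by
  rw [← h.L_Q x, h.K_L]

lemma L_K (h : IsPseudoInverse L K Q ρ ρ₂) (x : V) : L (K x) = L x := by
  rw [← h.Q_L x, h.L_Q, h.K_L]

lemma inner_L_nonneg (h : IsPseudoInverse L K Q ρ ρ₂) (x : V) : 0 ≤ ⟪x, L x⟫_ℝ :=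
  (mul_nonneg h.ρ₂_pos.le (sq_nonneg _)).trans (h.le_inner_L x)

lemma inner_L_Q (h : IsPseudoInverse L K Q ρ ρ₂) (x : V) :
    ⟪Q x, L (Q x)⟫_ℝ = ⟪x, Q x⟫_ℝ := by
  rw [h.L_Q, ← h.K_symm, h.K_Q, real_inner_comm]

lemma norm_L_le (h : IsPseudoInverse L K Q ρ ρ₂) (x : V) : ‖L x‖ ≤ ρ * ‖x‖ := by
  rcases (norm_nonneg (L x)).eq_or_lt with h₀ | hpos
  · rw [← h₀]
    exact mul_nonneg h.ρ_pos.le (norm_nonneg x)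
  · refine le_of_mul_le_mul_right ?_ hpos
    calc ‖L x‖ * ‖L x‖ ≤ ρ * ⟪x, L x⟫_ℝ := by rw [← sq]; exact h.norm_L_sq_le x
      _ ≤ ρ * (‖x‖ * ‖L x‖) := by gcongr; exacts [h.ρ_pos.le, real_inner_le_norm _ _]
      _ = ρ * ‖x‖ * ‖L x‖ := by ring

lemma inner_L_le (h : IsPseudoInverse L K Q ρ ρ₂) (x : V) : ⟪x, L x⟫_ℝ ≤ ρ * ‖x‖ ^ 2 :=
  calc ⟪x, L x⟫_ℝ ≤ ‖x‖ * ‖L x‖ := real_inner_le_norm _ _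
    _ ≤ ‖x‖ * (ρ * ‖x‖) := by gcongr; exact h.norm_L_le x
    _ = ρ * ‖x‖ ^ 2 := by ring

lemma norm_K_sq_le (h : IsPseudoInverse L K Q ρ ρ₂) (x : V) :
    ‖K x‖ ^ 2 ≤ ρ * ⟪x, Q x⟫_ℝ := by
  rw [← h.L_Q, ← h.inner_L_Q]
  exact h.norm_L_sq_le (Q x)

lemma norm_Q_sq_le (h : IsPseudoInverse L K Q ρ ρ₂) (x : V) :
    ρ₂ * ‖Q x‖ ^ 2 ≤ ⟪x, Q x⟫_ℝ := by
  rw [← h.inner_L_Q]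
  nth_rewrite 1 [← h.K_Q]
  exact h.le_inner_L (Q x)

lemma inner_Q_nonneg (h : IsPseudoInverse L K Q ρ ρ₂) (x : V) : 0 ≤ ⟪x, Q x⟫_ℝ :=
  (mul_nonneg h.ρ₂_pos.le (sq_nonneg _)).trans (h.norm_Q_sq_le x)

lemma norm_Q_le (h : IsPseudoInverse L K Q ρ ρ₂) (x : V) : ρ₂ * ‖Q x‖ ≤ ‖x‖ := by
  rcases (norm_nonneg (Q x)).eq_or_lt with h₀ | hpos
  · rw [← h₀, mul_zero]
    exact norm_nonneg x
  · refine le_of_mul_le_mul_right ?_ hpos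
    calc ρ₂ * ‖Q x‖ * ‖Q x‖ = ρ₂ * ‖Q x‖ ^ 2 := by ring
      _ ≤ ⟪x, Q x⟫_ℝ := h.norm_Q_sq_le x
      _ ≤ ‖x‖ * ‖Q x‖ := real_inner_le_norm _ _

lemma inner_Q_le (h : IsPseudoInverse L K Q ρ ρ₂) (x : V) : ρ₂ * ⟪x, Q x⟫_ℝ ≤ ‖x‖ ^ 2 :=
  calc ρ₂ * ⟪x, Q x⟫_ℝ ≤ ρ₂ * (‖x‖ * ‖Q x‖) := by
        gcongr; exacts [h.ρ₂_pos.le, real_inner_le_norm _ _]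
    _ = ‖x‖ * (ρ₂ * ‖Q x‖) := by ring
    _ ≤ ‖x‖ * ‖x‖ := by gcongr; exact h.norm_Q_le x
    _ = ‖x‖ ^ 2 := (sq _).symm

end IsPseudoInverse

lemma isPseudoInverse_laplacian {n : ℕ} (E : Type*) [NormedAddCommGroup E] [InnerProductSpace ℝ E]
    (hn : 2 ≤ n) {A : Matrix (Fin n) (Fin n) ℝ} (hA : IsUndirectedConnected A) :
    IsPseudoInverse (V := Stack (Fin n) E) (act (laplacian A)) (act (centering n))
      (act (laplacianPinv A)) (rho (laplacian A)) (rho2 (laplacian A)) where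
  L_symm := inner_act_of_isHermitian (laplacian_isHermitian hA.symm)
  K_symm := inner_act_of_isHermitian centering_isHermitian
  Q_symm := inner_act_of_isHermitian laplacianPinv_isHermitian
  Q_L x := by rw [← act_mul, laplacianPinv_mul_laplacian hA]
  L_Q x := by rw [← act_mul, laplacian_mul_laplacianPinv hA]
  K_L x := by rw [← act_mul, centering_mul_laplacian hA]
  K_Q x := by rw [← act_mul, centering_mul_laplacianPinv hA]
  ρ₂_pos := rho2_laplacian_pos hn hA
  ρ₂_le_ρ := rho2_le_rho_laplacian hn hA
  norm_L_sq_le x := by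
    rw [← real_inner_self_eq_norm_sq, inner_act_of_isHermitian (laplacian_isHermitian hA.symm),
      ← act_mul, ← real_inner_smul_right, ← act_smul]
    exact inner_act_mono (laplacian_mul_self_le hA) x
  le_inner_L x := by
    have hsq : ‖act (centering n) x‖ ^ 2 = ⟪x, act (centering n) x⟫_ℝ := by
      rw [← real_inner_self_eq_norm_sq, inner_act_of_isHermitian centering_isHermitian, ← act_mul,
        centering_mul_centering hA]
    rw [hsq, ← real_inner_smul_right, ← act_smul]
    exact inner_act_mono (rho2_smul_centering_le hA) x

/-! ### The consensus part of the Lyapunov function -/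

section Lyapunov

variable {V : Type*} [NormedAddCommGroup V] [InnerProductSpace ℝ V]

lemma abs_inner_le_young {c : ℝ} (hc : 0 < c) (x y : V) :
    |⟪x, y⟫_ℝ| ≤ c / 2 * ‖x‖ ^ 2 + 1 / (2 * c) * ‖y‖ ^ 2 := by
  have hsq : c / 2 * ‖x‖ ^ 2 + 1 / (2 * c) * ‖y‖ ^ 2 - ‖x‖ * ‖y‖ =
      1 / (2 * c) * (c * ‖x‖ - ‖y‖) ^ 2 := by
    field_simp
    ring
  have : 0 ≤ 1 / (2 * c) * (c * ‖x‖ - ‖y‖) ^ 2 := by positivity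
  linarith [abs_real_inner_le_norm x y]

lemma norm_sub_sq_le_two_mul (x y : V) : ‖x - y‖ ^ 2 ≤ 2 * (‖x‖ ^ 2 + ‖y‖ ^ 2) := by
  linarith [parallelogram_law_with_norm ℝ x y, mul_self_nonneg ‖x + y‖, sq ‖x - y‖, sq ‖x‖, sq ‖y‖]

variable {L K Q : V →ₗ[ℝ] V} {ρ ρ₂ : ℝ}

namespace IsPseudoInverse

lemma neg_inner_L_add_le (hT : IsPseudoInverse L K Q ρ ρ₂) (x e : V) :
    -⟪x, L x⟫_ℝ + ⟪x, L e⟫_ℝ ≤ -(ρ₂ / 2) * ‖K x‖ ^ 2 + ρ / 2 * ‖e‖ ^ 2 := by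
  have hsq : ⟪x - e, L (x - e)⟫_ℝ = ⟪x, L x⟫_ℝ - 2 * ⟪x, L e⟫_ℝ + ⟪e, L e⟫_ℝ := by
    rw [map_sub, inner_sub_right, inner_sub_left, inner_sub_left, ← hT.L_symm e x,
      real_inner_comm x (L e)]
    ring
  linarith [hT.inner_L_nonneg (x - e), hT.le_inner_L x, hT.inner_L_le e]

lemma neg_inner_le (hT : IsPseudoInverse L K Q ρ ρ₂) {w : V} (hw : K w = w) (e : V) :
    -⟪w, e⟫_ℝ ≤ 1 / 4 * ⟪w, Q w⟫_ℝ + ρ * ‖e‖ ^ 2 := by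
  have hρ := hT.ρ_pos
  have hyoung := abs_inner_le_young (by positivity : 0 < 2 * ρ) e w
  have hnorm := hT.norm_K_sq_le w
  rw [hw, ← div_le_iff₀' hρ] at hnorm
  have hscale : 1 / (2 * (2 * ρ)) * ‖w‖ ^ 2 = 1 / 4 * (‖w‖ ^ 2 / ρ) := by field_simp; ring
  rw [real_inner_comm] at hyoung
  linarith [neg_le_abs ⟪w, e⟫_ℝ]

lemma abs_inner_Q_left_le (hT : IsPseudoInverse L K Q ρ ρ₂) {c : ℝ} (hc : 0 < c) (w y : V) :
    |⟪Q w, y⟫_ℝ| ≤ c / 2 * ⟪w, Q w⟫_ℝ + 1 / (2 * c) * ρ₂⁻¹ * ‖y‖ ^ 2 := by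
  have hρ₂ := hT.ρ₂_pos
  calc |⟪Q w, y⟫_ℝ| ≤ c * ρ₂ / 2 * ‖Q w‖ ^ 2 + 1 / (2 * (c * ρ₂)) * ‖y‖ ^ 2 :=
        abs_inner_le_young (by positivity) _ _
    _ = c / 2 * (ρ₂ * ‖Q w‖ ^ 2) + 1 / (2 * c) * ρ₂⁻¹ * ‖y‖ ^ 2 := by field_simp
    _ ≤ c / 2 * ⟪w, Q w⟫_ℝ + 1 / (2 * c) * ρ₂⁻¹ * ‖y‖ ^ 2 := by
        gcongr
        exact hT.norm_Q_sq_le w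

lemma abs_inner_Q_right_le (hT : IsPseudoInverse L K Q ρ ρ₂) {c : ℝ} (hc : 0 < c) (x y : V) :
    c⁻¹ * |⟪x, Q y⟫_ℝ| ≤ 1 / 2 * ‖x‖ ^ 2 + 1 / (2 * c ^ 2) * ρ₂⁻¹ ^ 2 * ‖y‖ ^ 2 := by
  have hρ₂ := hT.ρ₂_pos
  have hQ : ‖Q y‖ ≤ ρ₂⁻¹ * ‖y‖ := (le_inv_mul_iff₀ hρ₂).mpr (hT.norm_Q_le y)
  calc c⁻¹ * |⟪x, Q y⟫_ℝ| ≤ c⁻¹ * (c / 2 * ‖x‖ ^ 2 + 1 / (2 * c) * ‖Q y‖ ^ 2) := by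
        gcongr
        exact abs_inner_le_young hc _ _
    _ ≤ c⁻¹ * (c / 2 * ‖x‖ ^ 2 + 1 / (2 * c) * (ρ₂⁻¹ * ‖y‖) ^ 2) := by gcongr
    _ = 1 / 2 * ‖x‖ ^ 2 + 1 / (2 * c ^ 2) * ρ₂⁻¹ ^ 2 * ‖y‖ ^ 2 := by field_simp

end IsPseudoInverse

/-- The consensus part of the Lyapunov function: `X` is the centered primal error and `W` the
scaled distance of the dual variables to their running equilibrium. -/
def lyap (Q : V →ₗ[ℝ] V) (τ : ℝ) (X W : V) : ℝ :=
  1 / 2 * ‖X‖ ^ 2 + (1 + τ) / 2 * ⟪W, Q W⟫_ℝ + ⟪X, Q W⟫_ℝ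

/-- The centered update direction of the primal variables, for compression error `E` and
gradient discrepancy `G`. -/
def direction (L : V →ₗ[ℝ] V) (β γ : ℝ) (X E W G : V) : V := β • L (X - E) + γ • W + G

/-- The coefficient of `α` in one step of `lyap`, where `α • D` is the drift of the gradients at
the average. -/
def lyapFirstOrder (L Q : V →ₗ[ℝ] V) (β γ : ℝ) (X E W G D : V) : ℝ :=
  -β * ⟪X, L X⟫_ℝ + β * ⟪X, L E⟫_ℝ + γ * ‖X‖ ^ 2 - γ * ⟪X, E⟫_ℝ - ⟪X, G⟫_ℝ - γ * ⟪W, E⟫_ℝ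
    - γ * ⟪W, Q W⟫_ℝ - ⟪Q W, G⟫_ℝ + (β + γ) / γ ^ 2 * ⟪Q W, D⟫_ℝ + γ⁻¹ * ⟪X, Q D⟫_ℝ

/-- The part of the coefficient of `α ^ 2` in one step of `lyap` that involves the drift. -/
def lyapDrift (Q : V →ₗ[ℝ] V) (β γ : ℝ) (S W G D : V) : ℝ :=
  ⟪S, D⟫_ℝ - ⟪W, Q D⟫_ℝ - γ⁻¹ * ⟪G, Q D⟫_ℝ + (β + γ) / (2 * γ ^ 3) * ⟪D, Q D⟫_ℝ

/-- The coefficient of `α ^ 2` in one step of `lyap`. -/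
def lyapSecondOrder (L Q : V →ₗ[ℝ] V) (β γ : ℝ) (X E W G D : V) : ℝ :=
  1 / 2 * ‖direction L β γ X E W G‖ ^ 2 - (β - γ) * γ / 2 * ⟪X - E, L (X - E)⟫_ℝ
    - γ ^ 2 * ⟪W, X - E⟫_ℝ - γ * ⟪G, X - E⟫_ℝ + lyapDrift Q β γ (X - E) W G D

lemma lyap_step_eq (hT : IsPseudoInverse L K Q ρ ρ₂) {β γ τ : ℝ} (hγ : γ ≠ 0)
    (hβ : β = τ * γ) {X E : V} (hX : K X = X) (hE : K E = E) (α : ℝ) (W G D : V) :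
    lyap Q τ (X - α • direction L β γ X E W G)
        (W + (α * γ) • L (X - E) + γ⁻¹ • α • D) =
      lyap Q τ X W + α * lyapFirstOrder L Q β γ X E W G D
        + α ^ 2 * lyapSecondOrder L Q β γ X E W G D := by
  obtain ⟨S, rfl⟩ : ∃ S, E = X - S := ⟨X - E, by abel⟩
  have hQL : Q (L S) = S := by
    rw [map_sub, hX] at hE
    rw [hT.Q_L]
    exact sub_right_injective hE
  have hLW : ⟪L S, Q W⟫_ℝ = ⟪S, W⟫_ℝ := by rw [← hT.Q_symm, hQL]
  have hLD : ⟪L S, Q D⟫_ℝ = ⟪S, D⟫_ℝ := by rw [← hT.Q_symm, hQL]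
  have hWD : ⟪W, Q D⟫_ℝ = ⟪Q W, D⟫_ℝ := (hT.Q_symm W D).symm
  simp only [lyap, lyapFirstOrder, lyapSecondOrder, lyapDrift, direction, sub_sub_cancel,
    ← real_inner_self_eq_norm_sq, map_add, map_sub, map_smul, hQL, inner_add_left,
    inner_add_right, inner_sub_left, inner_sub_right, real_inner_smul_left,
    real_inner_smul_right, hLW, hLD, hWD, real_inner_comm W S, real_inner_comm S (L S),
    real_inner_comm S D, real_inner_comm X W, real_inner_comm X G,
    real_inner_comm (Q W) G, real_inner_comm (Q W) D, real_inner_comm X (L S), hβ]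
  field_simp
  ring

lemma lyapFirstOrder_le (hT : IsPseudoInverse L K Q ρ ρ₂) {β γ ℓ p h : ℝ} (hβ : 0 < β)
    (hγ : 0 < γ) {X W G D : V} (hX : K X = X) (hW : K W = W)
    (hG : ‖G‖ ^ 2 + h ^ 2 ≤ ℓ ^ 2 * ‖X‖ ^ 2) (hD : ‖D‖ ^ 2 ≤ ℓ ^ 2 * p ^ 2) (E : V) :
    lyapFirstOrder L Q β γ X E W G D ≤
      -phi1 ρ₂ ℓ β γ * ‖X‖ ^ 2 - phi3 ρ₂ γ * ⟪W, Q W⟫_ℝ + phi7 ρ β γ * ‖E‖ ^ 2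
        + (1 / 8 - phi5 ρ₂ ℓ β γ) * p ^ 2 - 1 / 2 * h ^ 2 := by
  have hρ₂ := hT.ρ₂_pos
  have hXL := mul_le_mul_of_nonneg_left (hT.neg_inner_L_add_le X E) hβ.le
  have hXE := mul_le_mul_of_nonneg_left
    ((neg_le_abs _).trans (abs_inner_le_young one_pos X E)) hγ.le
  have hXG := (neg_le_abs _).trans (abs_inner_le_young one_pos X G)
  have hWE := mul_le_mul_of_nonneg_left (hT.neg_inner_le hW E) hγ.le
  have hWG := (neg_le_abs _).trans (hT.abs_inner_Q_left_le (by positivity : 0 < 5 * ρ₂⁻¹) W G)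
  have hWD := mul_le_mul_of_nonneg_left ((le_abs_self _).trans
    (hT.abs_inner_Q_left_le (by positivity : 0 < γ ^ 3 / (2 * (β + γ))) W D))
    (by positivity : 0 ≤ (β + γ) / γ ^ 2)
  have hXD := (mul_le_mul_of_nonneg_left (le_abs_self _) (inv_nonneg.mpr hγ.le)).trans
    (hT.abs_inner_Q_right_le hγ X D)
  have hWD_eq : (β + γ) / γ ^ 2 * (γ ^ 3 / (2 * (β + γ)) / 2 * ⟪W, Q W⟫_ℝ
        + 1 / (2 * (γ ^ 3 / (2 * (β + γ)))) * ρ₂⁻¹ * ‖D‖ ^ 2) =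
      γ / 4 * ⟪W, Q W⟫_ℝ + (β + γ) ^ 2 / γ ^ 5 * ρ₂⁻¹ * ‖D‖ ^ 2 := by
    field_simp
    ring
  have hWG_eq : 1 / (2 * (5 * ρ₂⁻¹)) * ρ₂⁻¹ * ‖G‖ ^ 2 = 1 / 10 * ‖G‖ ^ 2 := by
    field_simp
    ring
  rw [hWD_eq] at hWD
  rw [hWG_eq] at hWG
  rw [hX] at hXL
  have hDrift := mul_le_mul_of_nonneg_left hD
    (by positivity : 0 ≤ (β + γ) ^ 2 / γ ^ 5 * ρ₂⁻¹ + 1 / (2 * γ ^ 2) * ρ₂⁻¹ ^ 2)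
  rw [lyapFirstOrder, phi1, phi3, phi5, phi7]
  linarith [mul_nonneg hγ.le (sq_nonneg ‖E‖), sq_nonneg ‖G‖, sq_nonneg h]

lemma norm_direction_le (hT : IsPseudoInverse L K Q ρ ρ₂) {β γ : ℝ} (hβ : 0 ≤ β)
    (hγ : 0 ≤ γ) (X E W G : V) :
    ‖direction L β γ X E W G‖ ≤ ρ * β * ‖X‖ + ρ * β * ‖E‖ + γ * ‖W‖ + ‖G‖ := by
  calc ‖direction L β γ X E W G‖ ≤ ‖β • L (X - E)‖ + ‖γ • W‖ + ‖G‖ := norm_add₃_le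
    _ = β * ‖L (X - E)‖ + γ * ‖W‖ + ‖G‖ := by
        rw [norm_smul, norm_smul, Real.norm_of_nonneg hβ, Real.norm_of_nonneg hγ]
    _ ≤ β * (ρ * (‖X‖ + ‖E‖)) + γ * ‖W‖ + ‖G‖ := by
        gcongr
        exact (hT.norm_L_le _).trans
          (mul_le_mul_of_nonneg_left (norm_sub_le X E) hT.ρ_pos.le)
    _ = ρ * β * ‖X‖ + ρ * β * ‖E‖ + γ * ‖W‖ + ‖G‖ := by ring

lemma add_four_sq_le (a b c g : ℝ) :
    (a + b + c + g) ^ 2 ≤ 4 * a ^ 2 + 4 * b ^ 2 + 4 * c ^ 2 + 4 * g ^ 2 := by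
  nlinarith [sq_nonneg (a - b), sq_nonneg (a - c), sq_nonneg (b - c),
    sq_nonneg (a - g), sq_nonneg (b - g), sq_nonneg (c - g)]

-- The weights have reciprocals summing to one; taking `3` for `c` leaves room for the remaining
-- `⟪W, Q W⟫` terms, and the excess in `a` and `b` is absorbed by `4 * γ ≤ ρ₂ * β`.
lemma add_four_sq_le_weighted (a b c g : ℝ) :
    (a + b + c + g) ^ 2 ≤ 24 / 5 * a ^ 2 + 24 / 5 * b ^ 2 + 3 * c ^ 2 + 4 * g ^ 2 := by
  nlinarith [sq_nonneg (a - b), sq_nonneg (24 / 5 * a - 3 * c), sq_nonneg (24 / 5 * b - 3 * c),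
    sq_nonneg (24 / 5 * a - 4 * g), sq_nonneg (24 / 5 * b - 4 * g), sq_nonneg (3 * c - 4 * g)]

lemma norm_direction_sq_le (hT : IsPseudoInverse L K Q ρ ρ₂) {β γ η : ℝ} (hβ : 0 ≤ β)
    (hγ : 0 ≤ γ) (hη : 0 ≤ η) {W : V} (hW : K W = W) (X E G : V) :
    (1 / 2 + η) * ‖direction L β γ X E W G‖ ^ 2 ≤
      (12 / 5 + 4 * η) * (ρ ^ 2 * β ^ 2) * (‖X‖ ^ 2 + ‖E‖ ^ 2)
        + (3 / 2 + 4 * η) * ρ * γ ^ 2 * ⟪W, Q W⟫_ℝ + (2 + 4 * η) * ‖G‖ ^ 2 := by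
  have hsq := pow_le_pow_left₀ (norm_nonneg _) (norm_direction_le hT hβ hγ X E W G) 2
  have hfour := mul_le_mul_of_nonneg_left (hsq.trans (add_four_sq_le _ _ _ _)) hη
  have hweighted := hsq.trans (add_four_sq_le_weighted _ _ _ _)
  have hnorm := hT.norm_K_sq_le W
  rw [hW] at hnorm
  have hWQ := mul_le_mul_of_nonneg_left hnorm
    (by positivity : 0 ≤ (3 / 2 + 4 * η) * γ ^ 2)
  linarith

lemma lyapDrift_le (hT : IsPseudoInverse L K Q ρ ρ₂) {β γ ℓ p : ℝ} (hβ : 0 ≤ β) (hγ : 0 < γ)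
    {X W G D : V} (hW : K W = W) (hG : ‖G‖ ^ 2 ≤ ℓ ^ 2 * ‖X‖ ^ 2)
    (hD : ‖D‖ ^ 2 ≤ ℓ ^ 2 * p ^ 2) (E : V) :
    lyapDrift Q β γ (X - E) W G D ≤
      (1 + 1 / 2 * ℓ ^ 2) * ‖X‖ ^ 2 + ‖E‖ ^ 2 + 1 / 2 * ρ * ⟪W, Q W⟫_ℝ
        + (phi6 ρ₂ ℓ β γ - ℓ / 2) * p ^ 2 := by
  have hρ₂ := hT.ρ₂_pos
  have hSD := (le_abs_self _).trans (abs_inner_le_young one_pos (X - E) D)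
  have hWD := hT.abs_inner_Q_right_le one_pos W D
  have hGD := hT.abs_inner_Q_right_le hγ G D
  have hWD' := neg_le_abs ⟪W, Q D⟫_ℝ
  have hGD' := mul_le_mul_of_nonneg_left (neg_le_abs ⟪G, Q D⟫_ℝ) (inv_nonneg.mpr hγ.le)
  have hDD := mul_le_mul_of_nonneg_left ((le_inv_mul_iff₀ hρ₂).mpr (hT.inner_Q_le D))
    (by positivity : 0 ≤ (β + γ) / (2 * γ ^ 3))
  have hnorm := hT.norm_K_sq_le W
  rw [hW] at hnorm
  have hDrift := mul_le_mul_of_nonneg_left hD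
    (by positivity : 0 ≤ 1 / 2 + ρ₂⁻¹ ^ 2 / 2 + 1 / (2 * γ ^ 2) * ρ₂⁻¹ ^ 2
      + (β + γ) / (2 * γ ^ 3) * ρ₂⁻¹)
  rw [lyapDrift, phi6]
  linarith [norm_sub_sq_le_two_mul X E]

lemma lyapSecondOrder_cross_le (hT : IsPseudoInverse L K Q ρ ρ₂) {β γ ℓ : ℝ} (hβ : 0 ≤ β)
    (hγ : 0 < γ) (hℓ : 0 ≤ ℓ) (hℓγ : 2 * ℓ ≤ γ) {X W G : V} (hW : K W = W)
    (hG : ‖G‖ ^ 2 ≤ ℓ ^ 2 * ‖X‖ ^ 2) (E : V) :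
    -((β - γ) * γ / 2 * ⟪X - E, L (X - E)⟫_ℝ) - γ ^ 2 * ⟪W, X - E⟫_ℝ - γ * ⟪G, X - E⟫_ℝ ≤
      (ρ + 2) * γ ^ 2 * (‖X‖ ^ 2 + ‖E‖ ^ 2) + 1 / 2 * ρ * γ ^ 2 * ⟪W, Q W⟫_ℝ := by
  have hS := norm_sub_sq_le_two_mul X E
  have hSL := mul_le_mul_of_nonneg_left ((hT.inner_L_le (X - E)).trans
    (mul_le_mul_of_nonneg_left hS hT.ρ_pos.le)) (by positivity : 0 ≤ γ ^ 2 / 2)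
  have hSL_nonneg : 0 ≤ β * γ * ⟪X - E, L (X - E)⟫_ℝ :=
    mul_nonneg (by positivity) (hT.inner_L_nonneg _)
  have hnorm := hT.norm_K_sq_le W
  rw [hW] at hnorm
  have hWS := mul_le_mul_of_nonneg_left (show -⟪W, X - E⟫_ℝ ≤
      1 / 2 * (ρ * ⟪W, Q W⟫_ℝ) + (‖X‖ ^ 2 + ‖E‖ ^ 2) by
    linarith [(neg_le_abs _).trans (abs_inner_le_young one_pos W (X - E))]) (sq_nonneg γ)
  have hGn : ‖G‖ ≤ γ / 2 * ‖X‖ :=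
    (abs_le_of_sq_le_sq' (by rwa [mul_pow]) (by positivity)).2.trans
      (mul_le_mul_of_nonneg_right (by linarith) (norm_nonneg X))
  have hGS : -⟪G, X - E⟫_ℝ ≤ γ * (‖X‖ ^ 2 + ‖E‖ ^ 2) :=
    calc -⟪G, X - E⟫_ℝ ≤ ‖G‖ * ‖X - E‖ := (neg_le_abs _).trans (abs_real_inner_le_norm _ _)
      _ ≤ γ / 2 * ‖X‖ * (‖X‖ + ‖E‖) := by gcongr; exact norm_sub_le X E
      _ = γ / 2 * (‖X‖ * (‖X‖ + ‖E‖)) := mul_assoc _ _ _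
      _ ≤ γ / 2 * (2 * (‖X‖ ^ 2 + ‖E‖ ^ 2)) := by
          refine mul_le_mul_of_nonneg_left ?_ (by positivity)
          nlinarith [two_mul_le_add_sq ‖X‖ ‖E‖, sq_nonneg ‖E‖, sq_nonneg ‖X‖]
      _ = γ * (‖X‖ ^ 2 + ‖E‖ ^ 2) := by ring
  linarith [mul_le_mul_of_nonneg_left hGS hγ.le]

lemma lyapSecondOrder_le (hT : IsPseudoInverse L K Q ρ ρ₂) {β γ ℓ p ω r δ : ℝ}
    (hβ : 4 * γ ≤ ρ₂ * β) (hγ : 0 < γ) (hℓ : 0 ≤ ℓ) (hℓγ : 2 * ℓ ≤ γ)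
    (hη : 0 ≤ eps10 ω r δ) {X W G D : V} (hW : K W = W) (hG : ‖G‖ ^ 2 ≤ ℓ ^ 2 * ‖X‖ ^ 2)
    (hD : ‖D‖ ^ 2 ≤ ℓ ^ 2 * p ^ 2) (E : V) :
    lyapSecondOrder L Q β γ X E W G D + eps10 ω r δ * ‖direction L β γ X E W G‖ ^ 2 ≤
      phi2' ρ ρ₂ ℓ β γ ω r δ * ‖X‖ ^ 2 + phi4' ρ γ ω r δ * ⟪W, Q W⟫_ℝ
        + phi8' ρ ρ₂ β γ ω r δ * ‖E‖ ^ 2 + (phi6 ρ₂ ℓ β γ - ℓ / 2) * p ^ 2 := by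
  have hρ₂ := hT.ρ₂_pos
  have hβ₀ : 0 < β := pos_of_mul_pos_right (lt_of_lt_of_le (by positivity) hβ) hρ₂.le
  have hY := norm_direction_sq_le hT hβ₀.le hγ.le hη hW X E G
  have hcross := lyapSecondOrder_cross_le hT hβ₀.le hγ hℓ hℓγ hW hG E
  have hdrift := lyapDrift_le hT hβ₀.le hγ hW hG hD E
  have hG' := mul_le_mul_of_nonneg_left hG (by positivity : 0 ≤ 2 + 4 * eps10 ω r δ)
  have hβγ : 4 * (ρ₂ * β * γ) ≤ ρ ^ 2 * β ^ 2 :=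
    calc 4 * (ρ₂ * β * γ) = ρ₂ * β * (4 * γ) := by ring
      _ ≤ ρ₂ * β * (ρ₂ * β) := by gcongr
      _ ≤ ρ * β * (ρ * β) := by
          have hρ := hT.ρ_pos
          have := hT.ρ₂_le_ρ
          gcongr
      _ = ρ ^ 2 * β ^ 2 := by ring
  have hρβγ : ρ₂ * β * γ ≤ ρ * β * γ := by
    have := hT.ρ₂_le_ρ
    gcongr
  have hβγ₀ : 0 ≤ ρ₂ * β * γ := by positivity
  have hX' := mul_le_mul_of_nonneg_right
    (show ρ₂ * β * γ ≤ 3 / 5 * (ρ ^ 2 * β ^ 2) by linarith) (sq_nonneg ‖X‖)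
  have hE' := mul_le_mul_of_nonneg_right
    (show (2 * ρ₂ - ρ) * β * γ ≤ 3 / 5 * (ρ ^ 2 * β ^ 2) by linarith) (sq_nonneg ‖E‖)
  rw [lyapSecondOrder, phi2', phi4', phi8']
  linarith

lemma lyap_step_le (hT : IsPseudoInverse L K Q ρ ρ₂) {α β γ τ ℓ p h ω r δ : ℝ} (hα : 0 ≤ α)
    (hτ : 4 / ρ₂ ≤ τ) (hβ : β = τ * γ) (hγ : 0 < γ) (hℓ : 0 ≤ ℓ) (hℓγ : 2 * ℓ ≤ γ)
    (hη : 0 ≤ eps10 ω r δ) {X E W G D : V} (hX : K X = X) (hE : K E = E) (hW : K W = W)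
    (hG : ‖G‖ ^ 2 + h ^ 2 ≤ ℓ ^ 2 * ‖X‖ ^ 2) (hD : ‖D‖ ^ 2 ≤ ℓ ^ 2 * p ^ 2) :
    lyap Q τ (X - α • direction L β γ X E W G) (W + (α * γ) • L (X - E) + γ⁻¹ • α • D)
        + eps10 ω r δ * ‖α • direction L β γ X E W G‖ ^ 2 ≤
      lyap Q τ X W
        - α * (phi1 ρ₂ ℓ β γ - α * phi2' ρ ρ₂ ℓ β γ ω r δ) * ‖X‖ ^ 2
        - α * (phi3 ρ₂ γ - α * phi4' ρ γ ω r δ) * ⟪W, Q W⟫_ℝ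
        + (α * phi7 ρ β γ + α ^ 2 * phi8' ρ ρ₂ β γ ω r δ) * ‖E‖ ^ 2
        + α * (1 / 8 - phi5 ρ₂ ℓ β γ + α * (phi6 ρ₂ ℓ β γ - ℓ / 2)) * p ^ 2
        - α / 2 * h ^ 2 := by
  have hρ₂ := hT.ρ₂_pos
  have hβ₄ : 4 * γ ≤ ρ₂ * β := by
    rw [hβ, ← mul_assoc]
    gcongr
    exact (div_le_iff₀' hρ₂).mp hτ
  have hβ₀ : 0 < β := pos_of_mul_pos_right (lt_of_lt_of_le (by positivity) hβ₄) hρ₂.le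
  have hfirst := mul_le_mul_of_nonneg_left
    (lyapFirstOrder_le hT hβ₀ hγ hX hW hG hD E) hα
  have hsecond := mul_le_mul_of_nonneg_left
    (lyapSecondOrder_le hT hβ₄ hγ hℓ hℓγ hη hW (le_of_add_le_of_nonneg_left hG (sq_nonneg h)) hD E)
    (sq_nonneg α)
  rw [lyap_step_eq hT hγ.ne' hβ hX hE, norm_smul, mul_pow, Real.norm_eq_abs, sq_abs]
  linarith

lemma lyap_le (hT : IsPseudoInverse L K Q ρ ρ₂) {τ : ℝ} (hτ : 0 < τ) (X W : V) :
    lyap Q τ X W ≤ eps2 ρ₂ τ * (‖X‖ ^ 2 + ⟪W, Q W⟫_ℝ) := by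
  have hρ₂ := hT.ρ₂_pos
  have hcross : ⟪X, Q W⟫_ℝ ≤
      τ * ρ₂ / 2 * ‖X‖ ^ 2 + 1 / (2 * τ * ρ₂ ^ 2) * ⟪W, Q W⟫_ℝ :=
    calc ⟪X, Q W⟫_ℝ ≤ τ * ρ₂ / 2 * ‖X‖ ^ 2 + 1 / (2 * (τ * ρ₂)) * ‖Q W‖ ^ 2 :=
          (le_abs_self _).trans (abs_inner_le_young (by positivity) _ _)
      _ = τ * ρ₂ / 2 * ‖X‖ ^ 2 + 1 / (2 * τ * ρ₂ ^ 2) * (ρ₂ * ‖Q W‖ ^ 2) := by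
          field_simp
      _ ≤ τ * ρ₂ / 2 * ‖X‖ ^ 2 + 1 / (2 * τ * ρ₂ ^ 2) * ⟪W, Q W⟫_ℝ := by
          gcongr
          exact hT.norm_Q_sq_le W
  have hX : (1 + τ * ρ₂) / 2 * ‖X‖ ^ 2 ≤ eps2 ρ₂ τ * ‖X‖ ^ 2 := by
    gcongr
    exact le_max_left _ _
  have hW : ((1 + τ) / 2 + 1 / (2 * τ * ρ₂ ^ 2)) * ⟪W, Q W⟫_ℝ ≤ eps2 ρ₂ τ * ⟪W, Q W⟫_ℝ :=
    mul_le_mul_of_nonneg_right (le_max_right _ _) (hT.inner_Q_nonneg W)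
  rw [lyap]
  linarith

lemma le_lyap (hT : IsPseudoInverse L K Q ρ ρ₂) {τ : ℝ} (hτ : 4 / ρ₂ ≤ τ) (X W : V) :
    1 / 4 * ‖X‖ ^ 2 ≤ lyap Q τ X W := by
  have hρ₂ := hT.ρ₂_pos
  have hQ : 4 * ‖Q W‖ ^ 2 ≤ τ * ⟪W, Q W⟫_ℝ :=
    calc 4 * ‖Q W‖ ^ 2 = 4 / ρ₂ * (ρ₂ * ‖Q W‖ ^ 2) := by field_simp
      _ ≤ 4 / ρ₂ * ⟪W, Q W⟫_ℝ := by
          gcongr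
          exact hT.norm_Q_sq_le W
      _ ≤ τ * ⟪W, Q W⟫_ℝ := mul_le_mul_of_nonneg_right hτ (hT.inner_Q_nonneg W)
  have hcross := (neg_le_abs _).trans
    (abs_inner_le_young (by norm_num : (0 : ℝ) < 1 / 2) X (Q W))
  rw [lyap]
  linarith [hT.inner_Q_nonneg W, sq_nonneg ‖Q W‖]

end Lyapunov

/-! ### Smooth cost functions -/

section Cost

variable {n d : ℕ} {f : Fin n → EuclideanSpace ℝ (Fin d) → ℝ} {ℓ : ℝ}

lemma IsSmoothWith.continuous_gradient {h : EuclideanSpace ℝ (Fin d) → ℝ}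
    (hh : IsSmoothWith ℓ h) : Continuous (gradient h) :=
  (LipschitzWith.of_dist_le_mul (K := ℓ.toNNReal) fun x y => by
    rw [dist_eq_norm, dist_eq_norm]
    exact (hh.2 x y).trans
      (mul_le_mul_of_nonneg_right (Real.le_coe_toNNReal ℓ) (norm_nonneg _))).continuous

lemma IsSmoothWith.hasDerivAt_line {h : EuclideanSpace ℝ (Fin d) → ℝ} (hh : IsSmoothWith ℓ h)
    (x u : EuclideanSpace ℝ (Fin d)) (t : ℝ) :
    HasDerivAt (fun s : ℝ => h (x + s • u)) ⟪gradient h (x + t • u), u⟫_ℝ t := by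
  have hline : HasDerivAt (fun s : ℝ => x + s • u) u t := by
    simpa using ((hasDerivAt_id t).smul_const u).const_add x
  rw [inner_gradient_left]
  exact (hh.1 (x + t • u)).hasFDerivAt.comp_hasDerivAt t hline

lemma IsSmoothWith.le_quadratic {h : EuclideanSpace ℝ (Fin d) → ℝ}
    (hh : IsSmoothWith ℓ h) (x u : EuclideanSpace ℝ (Fin d)) :
    h (x + u) ≤ h x + ⟪gradient h x, u⟫_ℝ + ℓ / 2 * ‖u‖ ^ 2 := by
  let excess : ℝ → ℝ := fun t =>
    h (x + t • u) - (t * ⟪gradient h x, u⟫_ℝ + t ^ 2 * (ℓ / 2 * ‖u‖ ^ 2))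
  have hderiv : ∀ t, HasDerivAt excess
      (⟪gradient h (x + t • u), u⟫_ℝ - (⟪gradient h x, u⟫_ℝ + 2 * t * (ℓ / 2 * ‖u‖ ^ 2))) t :=
    fun t => by
    have hlin := (hasDerivAt_id t).mul_const ⟪gradient h x, u⟫_ℝ
    have hquad := (hasDerivAt_pow 2 t).mul_const (ℓ / 2 * ‖u‖ ^ 2)
    convert! (hh.hasDerivAt_line x u t).sub (hlin.add hquad) using 1
    norm_num
  have hanti : AntitoneOn excess (Set.Icc 0 1) := by
    refine antitoneOn_of_deriv_nonpos (convex_Icc 0 1)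
      (fun t _ => (hderiv t).continuousAt.continuousWithinAt)
      (fun t _ => (hderiv t).differentiableAt.differentiableWithinAt) fun t ht => ?_
    rw [interior_Icc] at ht
    have hlip := hh.2 (x + t • u) x
    rw [add_sub_cancel_left, norm_smul, Real.norm_of_nonneg ht.1.le] at hlip
    have hinner : ⟪gradient h (x + t • u) - gradient h x, u⟫_ℝ ≤ ℓ * (t * ‖u‖) * ‖u‖ :=
      (real_inner_le_norm _ _).trans (mul_le_mul_of_nonneg_right hlip (norm_nonneg u))
    rw [inner_sub_left] at hinner
    rw [(hderiv t).deriv]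
    linarith
  have hle := hanti (Set.left_mem_Icc.mpr zero_le_one) (Set.right_mem_Icc.mpr zero_le_one)
    zero_le_one
  simp only [excess, one_smul, zero_smul, add_zero] at hle
  linarith

lemma gradient_globalCost (hf : ∀ i, IsSmoothWith ℓ (f i)) (x : EuclideanSpace ℝ (Fin d)) :
    gradient (globalCost f) x = average fun i => gradient (f i) x := by
  refine HasGradientAt.gradient ?_
  rw [hasGradientAt_iff_hasFDerivAt]
  have h := (HasFDerivAt.fun_sum fun i (_ : i ∈ Finset.univ) =>
    ((hf i).1 x).hasFDerivAt).const_mul (1 / (n : ℝ))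
  convert! h using 1
  rw [average, map_smul, map_sum]
  simp only [toDual_gradient]

lemma norm_average_sub_le (hn : 0 < n) {a b : Fin n → EuclideanSpace ℝ (Fin d)} {c : ℝ}
    (h : ∀ i, ‖a i - b i‖ ≤ c) : ‖average a - average b‖ ≤ c := by
  have hn' : (0 : ℝ) < n := Nat.cast_pos.mpr hn
  rw [average, average, ← smul_sub, ← Finset.sum_sub_distrib, norm_smul,
    Real.norm_of_nonneg (by positivity), one_div, inv_mul_le_iff₀ hn']
  simpa using norm_sum_le_of_le Finset.univ fun i _ => h i

lemma isSmoothWith_globalCost (hn : 0 < n) (hf : ∀ i, IsSmoothWith ℓ (f i)) :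
    IsSmoothWith ℓ (globalCost f) := by
  refine ⟨fun x => (DifferentiableAt.fun_sum fun i _ => (hf i).1 x).const_mul _, fun x y => ?_⟩
  rw [gradient_globalCost hf, gradient_globalCost hf]
  exact norm_average_sub_le hn fun i => (hf i).2 x y

end Cost

/-! ### Averages of stacked vectors -/

section Average

variable {n d : ℕ}

/-- The space of stacked vectors with one block in `ℝ ^ d` for each of `n` agents. -/
abbrev AgentStack (n d : ℕ) : Type := Stack (Fin n) (EuclideanSpace ℝ (Fin d))

/-- The stacked vector with all blocks equal to a given vector, as a linear map. -/
def constStack (n d : ℕ) : EuclideanSpace ℝ (Fin d) →ₗ[ℝ] AgentStack n d where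
  toFun u := WithLp.toLp 2 fun _ => u
  map_add' _ _ := rfl
  map_smul' _ _ := rfl

/-- The average of the blocks of a stacked vector, as a linear map. -/
def avg (n d : ℕ) : AgentStack n d →ₗ[ℝ] EuclideanSpace ℝ (Fin d) where
  toFun x := average x.ofLp
  map_add' x y := by simp [average, Finset.sum_add_distrib]
  map_smul' c x := by simp [average, ← Finset.smul_sum, smul_comm c]

@[simp]
lemma constStack_apply (u : EuclideanSpace ℝ (Fin d)) (i : Fin n) : constStack n d u i = u := rfl

lemma avg_apply (x : AgentStack n d) : avg n d x = (1 / (n : ℝ)) • ∑ i, x i := rfl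

lemma norm_constStack_sq (u : EuclideanSpace ℝ (Fin d)) :
    ‖constStack n d u‖ ^ 2 = n * ‖u‖ ^ 2 := by
  simp only [PiLp.norm_sq_eq_of_L2 _ (constStack n d u), constStack_apply, Finset.sum_const,
    Finset.card_univ, Fintype.card_fin, nsmul_eq_mul]

lemma act_centering (x : AgentStack n d) :
    act (centering n) x = x - constStack n d (avg n d x) := by
  rw [centering, act_sub, act_one, act_smul]
  congr 1
  ext1 i
  simp [avg_apply]

lemma avg_constStack (hn : 0 < n) (u : EuclideanSpace ℝ (Fin d)) :
    avg n d (constStack n d u) = u := by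
  have : (n : ℝ) ≠ 0 := by positivity
  simp [avg_apply, ← Nat.cast_smul_eq_nsmul ℝ, smul_smul, this]

lemma avg_act_centering (hn : 0 < n) (x : AgentStack n d) : avg n d (act (centering n) x) = 0 := by
  rw [act_centering, map_sub, avg_constStack hn, sub_self]

lemma inner_constStack (hn : 0 < n) (x : AgentStack n d) (u : EuclideanSpace ℝ (Fin d)) :
    ⟪x, constStack n d u⟫_ℝ = n * ⟪avg n d x, u⟫_ℝ := by
  have : (n : ℝ) ≠ 0 := by positivity
  calc ⟪x, constStack n d u⟫_ℝ = ∑ i, ⟪x i, u⟫_ℝ := PiLp.inner_apply _ _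
    _ = n * ⟪(1 / (n : ℝ)) • ∑ i, x i, u⟫_ℝ := by
        rw [real_inner_smul_left, sum_inner]
        field_simp

lemma norm_sq_eq_centering_add (hn : 0 < n) (x : AgentStack n d) :
    ‖x‖ ^ 2 = ‖act (centering n) x‖ ^ 2 + ‖constStack n d (avg n d x)‖ ^ 2 := by
  have horth : ⟪act (centering n) x, constStack n d (avg n d x)⟫_ℝ = 0 := by
    rw [inner_constStack hn, avg_act_centering hn, inner_zero_left, mul_zero]
  have hsplit : x = act (centering n) x + constStack n d (avg n d x) := by
    rw [act_centering, sub_add_cancel]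
  conv_lhs => rw [hsplit]
  rw [norm_add_sq_real, horth, mul_zero, add_zero]

lemma norm_centering_sq_le (hn : 0 < n) (x : AgentStack n d) :
    ‖act (centering n) x‖ ^ 2 ≤ ‖x‖ ^ 2 := by
  rw [norm_sq_eq_centering_add hn x]
  exact le_add_of_nonneg_right (sq_nonneg _)

lemma avg_act_laplacian (hn : 0 < n) {A : Matrix (Fin n) (Fin n) ℝ} (hA : IsUndirectedConnected A)
    (x : AgentStack n d) : avg n d (act (laplacian A) x) = 0 := by
  rw [← centering_mul_laplacian hA, act_mul, avg_act_centering hn]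

end Average

/-! ### Consequences of the parameter choice -/

section Parameters

lemma quadratic_lt_of_lt_root {a b c t : ℝ} (ha : 0 < a) (hb : 0 ≤ b) (ht : 0 ≤ t)
    (h : t < (√(b ^ 2 + 4 * a * c) - b) / (2 * a)) : t * b + t ^ 2 * a < c := by
  rw [lt_div_iff₀ (by positivity), lt_sub_iff_add_lt, Real.lt_sqrt (by positivity)] at h
  have : 0 < 4 * a * (c - (t * b + t ^ 2 * a)) := by linarith
  linarith [pos_of_mul_pos_right this (by positivity)]

/-- The conditions on the parameters under which the Lyapunov function contracts. -/
structure Admissible (ρ ρ₂ ℓ α β γ τ ω r δ : ℝ) : Prop where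
  rho2_pos : 0 < ρ₂
  rho2_le_rho : ρ₂ ≤ ρ
  ell_pos : 0 < ℓ
  two_mul_ell_le : 2 * ℓ ≤ γ
  kappa1_le : kappa1 ρ₂ ≤ τ
  beta_eq : β = τ * γ
  r_pos : 0 < r
  delta_mem : δ ∈ Set.Ioc (0 : ℝ) 1
  omega_mem : ω ∈ Set.Ioc (0 : ℝ) (1 / r)
  alpha_mem : α ∈ Set.Ioo (0 : ℝ) (kappa0' ρ ρ₂ ℓ β γ ω r δ)

namespace Admissible

variable {ρ ρ₂ ℓ α β γ τ ω r δ : ℝ}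

lemma alpha_pos (h : Admissible ρ ρ₂ ℓ α β γ τ ω r δ) : 0 < α := h.alpha_mem.1

lemma rho_pos (h : Admissible ρ ρ₂ ℓ α β γ τ ω r δ) : 0 < ρ := h.rho2_pos.trans_le h.rho2_le_rho

lemma gamma_pos (h : Admissible ρ ρ₂ ℓ α β γ τ ω r δ) : 0 < γ := by
  linarith [h.ell_pos, h.two_mul_ell_le]

lemma four_mul_gamma_le (h : Admissible ρ ρ₂ ℓ α β γ τ ω r δ) : 4 * γ ≤ ρ₂ * β := by
  have := mul_le_mul_of_nonneg_right ((div_le_iff₀ h.rho2_pos).mp h.kappa1_le) h.gamma_pos.le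
  rw [h.beta_eq]
  linarith

lemma beta_pos (h : Admissible ρ ρ₂ ℓ α β γ τ ω r δ) : 0 < β :=
  pos_of_mul_pos_right (by linarith [h.four_mul_gamma_le, h.gamma_pos]) h.rho2_pos.le

lemma eps9_pos (h : Admissible ρ ρ₂ ℓ α β γ τ ω r δ) : 0 < eps9 ω r δ :=
  half_pos (mul_pos (mul_pos h.omega_mem.1 h.r_pos) h.delta_mem.1)

lemma two_mul_eps9_le_one (h : Admissible ρ ρ₂ ℓ α β γ τ ω r δ) : 2 * eps9 ω r δ ≤ 1 := by
  rw [eps9, mul_div_cancel₀ _ two_ne_zero]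
  exact mul_le_one₀ ((le_div_iff₀ h.r_pos).mp h.omega_mem.2) h.delta_mem.1.le h.delta_mem.2

lemma eps10_nonneg (h : Admissible ρ ρ₂ ℓ α β γ τ ω r δ) : 0 ≤ eps10 ω r δ :=
  mul_nonneg (by linarith [h.two_mul_eps9_le_one]) (by have := h.eps9_pos; positivity)

lemma sq_rho2_mul_beta_le (h : Admissible ρ ρ₂ ℓ α β γ τ ω r δ) :
    (ρ₂ * β) ^ 2 ≤ ρ ^ 2 * β ^ 2 := by
  rw [← mul_pow]
  have := h.rho2_pos
  have := h.beta_pos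
  have := h.rho2_le_rho
  gcongr

lemma four_mul_rho2_mul_beta_mul_gamma_le (h : Admissible ρ ρ₂ ℓ α β γ τ ω r δ) :
    4 * (ρ₂ * β * γ) ≤ ρ ^ 2 * β ^ 2 := by
  have := mul_le_mul_of_nonneg_left h.four_mul_gamma_le (mul_pos h.rho2_pos h.beta_pos).le
  linarith [h.sq_rho2_mul_beta_le]

lemma lt_phi2' (h : Admissible ρ ρ₂ ℓ α β γ τ ω r δ) :
    4 * eps10 ω r δ * (ρ ^ 2 * β ^ 2) < phi2' ρ ρ₂ ℓ β γ ω r δ := by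
  have := h.eps10_nonneg
  have := h.rho_pos
  have hγ : 0 ≤ (ρ + 2) * γ ^ 2 := by positivity
  have hℓ : 0 ≤ (5 / 2 + 4 * eps10 ω r δ) * ℓ ^ 2 := by positivity
  have hβγ : 0 < ρ₂ * β * γ := mul_pos (mul_pos h.rho2_pos h.beta_pos) h.gamma_pos
  rw [phi2']
  linarith [h.four_mul_rho2_mul_beta_mul_gamma_le]

lemma phi7_pos (h : Admissible ρ ρ₂ ℓ α β γ τ ω r δ) : 0 < phi7 ρ β γ := by
  have := h.rho_pos
  have := h.gamma_pos
  have := h.beta_pos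
  rw [phi7]
  positivity

lemma phi8'_pos (h : Admissible ρ ρ₂ ℓ α β γ τ ω r δ) : 0 < phi8' ρ ρ₂ β γ ω r δ := by
  have := h.eps10_nonneg
  have := h.rho_pos
  have := h.gamma_pos
  have := h.beta_pos
  have hγ : 0 ≤ (ρ + 2) * γ ^ 2 := by positivity
  have hη : 0 ≤ 4 * eps10 ω r δ * (ρ ^ 2 * β ^ 2) := by positivity
  have hβγ : 0 ≤ ρ * β * γ := by positivity
  rw [phi8']
  linarith [h.four_mul_rho2_mul_beta_mul_gamma_le,
    mul_pos (mul_pos h.rho2_pos h.beta_pos) h.gamma_pos]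

lemma alpha_mul_phi2'_lt (h : Admissible ρ ρ₂ ℓ α β γ τ ω r δ) :
    α * phi2' ρ ρ₂ ℓ β γ ω r δ < phi1 ρ₂ ℓ β γ := by
  have := h.eps10_nonneg
  have hpos : 0 < phi2' ρ ρ₂ ℓ β γ ω r δ := lt_of_le_of_lt (by positivity) h.lt_phi2'
  exact (lt_div_iff₀ hpos).mp
    (h.alpha_mem.2.trans_le ((min_le_left _ _).trans (min_le_left _ _)))

lemma alpha_mul_phi4'_lt (h : Admissible ρ ρ₂ ℓ α β γ τ ω r δ) :
    α * phi4' ρ γ ω r δ < phi3 ρ₂ γ := by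
  have := h.eps10_nonneg
  have := h.rho_pos
  have hpos : 0 < phi4' ρ γ ω r δ := by rw [phi4']; positivity
  exact (lt_div_iff₀ hpos).mp
    (h.alpha_mem.2.trans_le ((min_le_left _ _).trans (min_le_right _ _)))

lemma alpha_mul_phi6_lt (h : Admissible ρ ρ₂ ℓ α β γ τ ω r δ) :
    α * phi6 ρ₂ ℓ β γ < phi5 ρ₂ ℓ β γ := by
  have := h.rho2_pos
  have := h.ell_pos
  have := h.gamma_pos
  have := h.beta_pos
  have hpos : 0 < phi6 ρ₂ ℓ β γ := by rw [phi6]; positivity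
  exact (lt_div_iff₀ hpos).mp
    (h.alpha_mem.2.trans_le ((min_le_right _ _).trans (min_le_left _ _)))

lemma alpha_mul_phi7_add_lt (h : Admissible ρ ρ₂ ℓ α β γ τ ω r δ) :
    α * phi7 ρ β γ + α ^ 2 * phi8' ρ ρ₂ β γ ω r δ < 2 * eps12 ω r δ := by
  refine quadratic_lt_of_lt_root h.phi8'_pos h.phi7_pos.le h.alpha_pos.le
    ((h.alpha_mem.2.trans_le ((min_le_right _ _).trans (min_le_right _ _))).trans_eq ?_)
  congr 4
  ring

lemma alpha_mul_phi7_add_nonneg (h : Admissible ρ ρ₂ ℓ α β γ τ ω r δ) :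
    0 ≤ α * phi7 ρ β γ + α ^ 2 * phi8' ρ ρ₂ β γ ω r δ :=
  add_nonneg (mul_pos h.alpha_pos h.phi7_pos).le (mul_pos (pow_pos h.alpha_pos 2) h.phi8'_pos).le

lemma alpha_mul_eps10_le (h : Admissible ρ ρ₂ ℓ α β γ τ ω r δ) : α * eps10 ω r δ ≤ 1 / 8 := by
  have hη := h.eps10_nonneg
  have hα := h.alpha_pos
  have hρβ : 0 < ρ₂ * β := mul_pos h.rho2_pos h.beta_pos
  have hphi1 : phi1 ρ₂ ℓ β γ ≤ 1 / 2 * (ρ₂ * β) - 1 := by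
    rw [phi1]
    linarith [sq_nonneg ℓ, h.gamma_pos]
  have hphi2 := mul_lt_mul_of_pos_left h.lt_phi2' hα
  have hρβ_ge : 1 ≤ ρ₂ * β := by
    have : 0 ≤ α * (4 * eps10 ω r δ * (ρ ^ 2 * β ^ 2)) := by positivity
    linarith [h.alpha_mul_phi2'_lt]
  have hsq : ρ₂ * β ≤ ρ ^ 2 * β ^ 2 :=
    (le_self_pow₀ hρβ_ge two_ne_zero).trans h.sq_rho2_mul_beta_le
  refine le_of_mul_le_mul_right (a := ρ ^ 2 * β ^ 2) ?_ (hρβ.trans_le hsq)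
  linarith [h.alpha_mul_phi2'_lt]

lemma tau_pos (h : Admissible ρ ρ₂ ℓ α β γ τ ω r δ) : 0 < τ :=
  (div_pos four_pos h.rho2_pos).trans_le h.kappa1_le

lemma one_le_eps2 (h : Admissible ρ ρ₂ ℓ α β γ τ ω r δ) : 1 ≤ eps2 ρ₂ τ := by
  have := (div_le_iff₀ h.rho2_pos).mp h.kappa1_le
  exact le_trans (by linarith) (le_max_left _ _)

lemma eps6_pos (h : Admissible ρ ρ₂ ℓ α β γ τ ω r δ) {ν : ℝ} (hν : 0 < ν) :
    0 < eps6' ρ ρ₂ ℓ ν α β γ τ ω r δ := by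
  refine div_pos (lt_min (half_pos hν) (lt_min (lt_min ?_ ?_) (div_pos ?_ h.alpha_pos)))
    (zero_lt_one.trans_le h.one_le_eps2)
  · exact sub_pos.mpr h.alpha_mul_phi2'_lt
  · exact sub_pos.mpr h.alpha_mul_phi4'_lt
  · linarith [h.alpha_mul_phi7_add_lt]

lemma eps6_mul_eps2 (h : Admissible ρ ρ₂ ℓ α β γ τ ω r δ) (ν : ℝ) :
    eps6' ρ ρ₂ ℓ ν α β γ τ ω r δ * eps2 ρ₂ τ = min (ν / 2) (min (eps3' ρ ρ₂ ℓ α β γ ω r δ)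
      ((2 * eps12 ω r δ - α * phi7 ρ β γ - α ^ 2 * phi8' ρ ρ₂ β γ ω r δ) / α)) :=
  div_mul_cancel₀ _ (zero_lt_one.trans_le h.one_le_eps2).ne'

lemma eps6_le_self (h : Admissible ρ ρ₂ ℓ α β γ τ ω r δ) {ν : ℝ} (hν : 0 < ν) :
    eps6' ρ ρ₂ ℓ ν α β γ τ ω r δ ≤ eps6' ρ ρ₂ ℓ ν α β γ τ ω r δ * eps2 ρ₂ τ :=
  le_mul_of_one_le_right (h.eps6_pos hν).le h.one_le_eps2

lemma eps6_le (h : Admissible ρ ρ₂ ℓ α β γ τ ω r δ) {ν : ℝ} (hν : 0 < ν) :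
    eps6' ρ ρ₂ ℓ ν α β γ τ ω r δ ≤ ν := by
  have := (h.eps6_le_self hν).trans ((h.eps6_mul_eps2 ν).trans_le (min_le_left _ _))
  linarith

lemma eps6_mul_eps2_le_eps3 (h : Admissible ρ ρ₂ ℓ α β γ τ ω r δ) (ν : ℝ) :
    eps6' ρ ρ₂ ℓ ν α β γ τ ω r δ * eps2 ρ₂ τ ≤ eps3' ρ ρ₂ ℓ α β γ ω r δ :=
  (h.eps6_mul_eps2 ν).trans_le ((min_le_right _ _).trans (min_le_left _ _))

lemma alpha_mul_eps6_le (h : Admissible ρ ρ₂ ℓ α β γ τ ω r δ) {ν : ℝ} (hν : 0 < ν) :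
    α * eps6' ρ ρ₂ ℓ ν α β γ τ ω r δ ≤
      2 * eps12 ω r δ - α * phi7 ρ β γ - α ^ 2 * phi8' ρ ρ₂ β γ ω r δ := by
  rw [← le_div_iff₀' h.alpha_pos]
  exact (h.eps6_le_self hν).trans
    ((h.eps6_mul_eps2 ν).trans_le ((min_le_right _ _).trans (min_le_right _ _)))

end Admissible

end Parameters

/-! ### One step of the Lyapunov function -/

section Descent

lemma IsPseudoInverse.map_direction {V : Type*} [NormedAddCommGroup V] [InnerProductSpace ℝ V]
    {L K Q : V →ₗ[ℝ] V} {ρ ρ₂ : ℝ} (hT : IsPseudoInverse L K Q ρ ρ₂) {γ : ℝ} (hγ : γ ≠ 0) (β : ℝ)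
    (x e v g g₀ : V) :
    K (direction L β γ x e v g) =
      direction L β γ (K x) (K e) (K (v + γ⁻¹ • g₀)) (K (g - g₀)) := by
  simp only [direction, map_add, map_sub, map_smul, hT.K_L, hT.L_K, smul_add, smul_smul,
    mul_inv_cancel₀ hγ, one_smul]
  abel

lemma norm_add_sq_le_young {V : Type*} [SeminormedAddCommGroup V] {c : ℝ} (hc : 0 < c) (x y : V) :
    ‖x + y‖ ^ 2 ≤ (1 + c) * ‖x‖ ^ 2 + (1 + c⁻¹) * ‖y‖ ^ 2 := by
  have hsq : (1 + c) * ‖x‖ ^ 2 + (1 + c⁻¹) * ‖y‖ ^ 2 - (‖x‖ + ‖y‖) ^ 2 =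
      c⁻¹ * (c * ‖x‖ - ‖y‖) ^ 2 := by
    field_simp
    ring
  have hnonneg : 0 ≤ c⁻¹ * (c * ‖x‖ - ‖y‖) ^ 2 := by positivity
  linarith [pow_le_pow_left₀ (norm_nonneg _) (norm_add_le x y) 2]

lemma Admissible.eps9_mul_norm_sub_sq_le {V : Type*} [SeminormedAddCommGroup V]
    {ρ ρ₂ ℓ α β γ τ ω r δ : ℝ} (hP : Admissible ρ ρ₂ ℓ α β γ τ ω r δ) (e u : V) :
    (1 - 2 * eps9 ω r δ) * ‖e - u‖ ^ 2 ≤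
      (1 - 2 * eps12 ω r δ) * ‖e‖ ^ 2 + eps10 ω r δ * ‖u‖ ^ 2 := by
  have hyoung := norm_add_sq_le_young hP.eps9_pos e (-u)
  rw [← sub_eq_add_neg, norm_neg] at hyoung
  have hscaled := mul_le_mul_of_nonneg_left hyoung (sub_nonneg.mpr hP.two_mul_eps9_le_one)
  rw [eps12, eps10]
  linarith

lemma eps3'_le_left (ρ ρ₂ ℓ α β γ ω r δ : ℝ) :
    eps3' ρ ρ₂ ℓ α β γ ω r δ ≤ phi1 ρ₂ ℓ β γ - α * phi2' ρ ρ₂ ℓ β γ ω r δ :=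
  min_le_left _ _

lemma eps3'_le_right (ρ ρ₂ ℓ α β γ ω r δ : ℝ) :
    eps3' ρ ρ₂ ℓ α β γ ω r δ ≤ phi3 ρ₂ γ - α * phi4' ρ γ ω r δ :=
  min_le_right _ _

variable {n d : ℕ} {f : Fin n → EuclideanSpace ℝ (Fin d) → ℝ} {ℓ : ℝ}

/-- The stacked gradients of the local costs. -/
def gradStack (f : Fin n → EuclideanSpace ℝ (Fin d) → ℝ) (x : AgentStack n d) : AgentStack n d :=
  WithLp.toLp 2 fun i => gradient (f i) (x i)

/-- The stacked gradients of the local costs at the average. -/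
def gradAvg (f : Fin n → EuclideanSpace ℝ (Fin d) → ℝ) (x : AgentStack n d) : AgentStack n d :=
  gradStack f (constStack n d (avg n d x))

/-- The optimality gap at the average, summed over the agents. -/
def gap (f : Fin n → EuclideanSpace ℝ (Fin d) → ℝ) (x : AgentStack n d) : ℝ :=
  n * (globalCost f (avg n d x) - optValue f)

/-- The scaled distance of the dual variables `v` to their running equilibrium
`-γ⁻¹ ∇f_i(x̄)`, up to consensus. -/
def dualError (f : Fin n → EuclideanSpace ℝ (Fin d) → ℝ) (γ : ℝ) (x v : AgentStack n d) :
    AgentStack n d :=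
  act (centering n) (v + γ⁻¹ • gradAvg f x)

/-- The Lyapunov function, up to the compression error. -/
def lyapunov (f : Fin n → EuclideanSpace ℝ (Fin d) → ℝ) (A : Matrix (Fin n) (Fin n) ℝ)
    (τ γ : ℝ) (x v : AgentStack n d) : ℝ :=
  lyap (act (laplacianPinv A)) τ (act (centering n) x) (dualError f γ x v) + gap f x

lemma gap_nonneg (hbdd : BddBelow (Set.range (globalCost f))) (x : AgentStack n d) : 0 ≤ gap f x :=
  mul_nonneg n.cast_nonneg (sub_nonneg.mpr (ciInf_le hbdd _))

lemma norm_gradStack_sub_sq_le (hf : ∀ i, IsSmoothWith ℓ (f i)) (x y : AgentStack n d) :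
    ‖gradStack f x - gradStack f y‖ ^ 2 ≤ ℓ ^ 2 * ‖x - y‖ ^ 2 := by
  rw [PiLp.norm_sq_eq_of_L2, PiLp.norm_sq_eq_of_L2, Finset.mul_sum]
  refine Finset.sum_le_sum fun i _ => ?_
  rw [← mul_pow]
  exact pow_le_pow_left₀ (norm_nonneg _) ((hf i).2 (x i) (y i)) 2

lemma norm_gradAvg_sub_sq_le (hf : ∀ i, IsSmoothWith ℓ (f i)) (x y : AgentStack n d) :
    ‖gradAvg f x - gradAvg f y‖ ^ 2 ≤ ℓ ^ 2 * ‖constStack n d (avg n d (x - y))‖ ^ 2 := by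
  rw [map_sub, map_sub]
  exact norm_gradStack_sub_sq_le hf _ _

lemma norm_grad_discrepancy_sq_le (hn : 0 < n) (hf : ∀ i, IsSmoothWith ℓ (f i))
    (x : AgentStack n d) :
    ‖act (centering n) (gradStack f x - gradAvg f x)‖ ^ 2
        + ‖constStack n d (avg n d (gradStack f x - gradAvg f x))‖ ^ 2 ≤
      ℓ ^ 2 * ‖act (centering n) x‖ ^ 2 := by
  rw [← norm_sq_eq_centering_add hn, act_centering]
  exact norm_gradStack_sub_sq_le hf _ _

lemma avg_gradAvg (hf : ∀ i, IsSmoothWith ℓ (f i)) (x : AgentStack n d) :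
    avg n d (gradAvg f x) = gradient (globalCost f) (avg n d x) :=
  (gradient_globalCost hf (avg n d x)).symm

lemma gap_step_le (hn : 0 < n) (hf : ∀ i, IsSmoothWith ℓ (f i)) {ν α : ℝ} (hPL : PLCondition ν f)
    (hα : 0 ≤ α) {x x' : AgentStack n d}
    (hx' : avg n d x' = avg n d x - α • avg n d (gradStack f x)) :
    gap f x' ≤ gap f x - α * ν * gap f x
      - α / 2 * ‖constStack n d (avg n d (gradStack f x))‖ ^ 2
      + α / 2 * ‖constStack n d (avg n d (gradStack f x - gradAvg f x))‖ ^ 2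
      + α ^ 2 * (ℓ / 2) * ‖constStack n d (avg n d (gradStack f x))‖ ^ 2 := by
  have hn' : (0 : ℝ) ≤ n := n.cast_nonneg
  have hquad := mul_le_mul_of_nonneg_left ((isSmoothWith_globalCost hn hf).le_quadratic
    (avg n d x) (-(α • avg n d (gradStack f x)))) hn'
  rw [← sub_eq_add_neg, norm_neg, norm_smul, inner_neg_right, real_inner_smul_right, mul_pow,
    Real.norm_eq_abs, sq_abs] at hquad
  have hgrad := mul_le_mul_of_nonneg_left (hPL (avg n d x)) (mul_nonneg hα hn')
  rw [gap, gap, hx', map_sub, avg_gradAvg hf, norm_constStack_sq, norm_constStack_sq,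
    norm_sub_sq_real, real_inner_comm]
  linarith

variable {A : Matrix (Fin n) (Fin n) ℝ} {α β γ τ ω r δ ν : ℝ} {x e v : AgentStack n d}

lemma avg_direction (hn : 0 < n) (hA : IsUndirectedConnected A) (hv : avg n d v = 0)
    (β γ : ℝ) (x e g : AgentStack n d) :
    avg n d (direction (act (laplacian A)) β γ x e v g) = avg n d g := by
  simp [direction, avg_act_laplacian hn hA, hv]

lemma norm_smul_direction_sq (hn : 0 < n) (hA : IsUndirectedConnected A) (hv : avg n d v = 0)
    (α β γ : ℝ) (x e g : AgentStack n d) :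
    ‖α • direction (act (laplacian A)) β γ x e v g‖ ^ 2 =
      ‖α • act (centering n) (direction (act (laplacian A)) β γ x e v g)‖ ^ 2
        + α ^ 2 * ‖constStack n d (avg n d g)‖ ^ 2 := by
  rw [norm_smul, mul_pow, norm_sq_eq_centering_add hn, avg_direction hn hA hv, norm_smul, mul_pow,
    mul_add, Real.norm_eq_abs, sq_abs]

lemma dualError_step (hn : 2 ≤ n) (hA : IsUndirectedConnected A)
    (f : Fin n → EuclideanSpace ℝ (Fin d) → ℝ) (α γ : ℝ) (x x' v e : AgentStack n d) :
    dualError f γ x' (v + (α * γ) • act (laplacian A) (x - e)) =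
      dualError f γ x v
        + (α * γ) • act (laplacian A) (act (centering n) x - act (centering n) e)
        + γ⁻¹ • act (centering n) (gradAvg f x' - gradAvg f x) := by
  have hT := isPseudoInverse_laplacian (EuclideanSpace ℝ (Fin d)) hn hA
  simp only [dualError, map_add, map_sub, map_smul, hT.K_L, hT.L_K, smul_sub]
  abel

lemma lyap_dualError_step_le (hn : 2 ≤ n) (hA : IsUndirectedConnected A)
    (hf : ∀ i, IsSmoothWith ℓ (f i))
    (hP : Admissible (rho (laplacian A)) (rho2 (laplacian A)) ℓ α β γ τ ω r δ)
    (hv : avg n d v = 0) {x' v' : AgentStack n d}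
    (hx' : x' = x - α • direction (act (laplacian A)) β γ x e v (gradStack f x))
    (hv' : v' = v + (α * γ) • act (laplacian A) (x - e)) :
    lyap (act (laplacianPinv A)) τ (act (centering n) x') (dualError f γ x' v')
        + eps10 ω r δ * ‖act (centering n) (x - x')‖ ^ 2 ≤
      lyap (act (laplacianPinv A)) τ (act (centering n) x) (dualError f γ x v)
        - α * (phi1 (rho2 (laplacian A)) ℓ β γ
          - α * phi2' (rho (laplacian A)) (rho2 (laplacian A)) ℓ β γ ω r δ)
          * ‖act (centering n) x‖ ^ 2
        - α * (phi3 (rho2 (laplacian A)) γ - α * phi4' (rho (laplacian A)) γ ω r δ)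
          * ⟪dualError f γ x v, act (laplacianPinv A) (dualError f γ x v)⟫_ℝ
        + (α * phi7 (rho (laplacian A)) β γ
          + α ^ 2 * phi8' (rho (laplacian A)) (rho2 (laplacian A)) β γ ω r δ) * ‖e‖ ^ 2
        + α * (1 / 8 - phi5 (rho2 (laplacian A)) ℓ β γ
          + α * (phi6 (rho2 (laplacian A)) ℓ β γ - ℓ / 2))
          * ‖constStack n d (avg n d (gradStack f x))‖ ^ 2
        - α / 2 * ‖constStack n d (avg n d (gradStack f x - gradAvg f x))‖ ^ 2 := by
  have hn0 : 0 < n := by omega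
  have hT := isPseudoInverse_laplacian (EuclideanSpace ℝ (Fin d)) hn hA
  have hα := hP.alpha_pos
  set D := α⁻¹ • act (centering n) (gradAvg f x' - gradAvg f x) with hD
  have hDle : ‖D‖ ^ 2 ≤ ℓ ^ 2 * ‖constStack n d (avg n d (gradStack f x))‖ ^ 2 :=
    calc ‖D‖ ^ 2 = (α ^ 2)⁻¹ * ‖act (centering n) (gradAvg f x' - gradAvg f x)‖ ^ 2 := by
          rw [hD, norm_smul, mul_pow, norm_inv, inv_pow, Real.norm_eq_abs, sq_abs]
      _ ≤ (α ^ 2)⁻¹ * (ℓ ^ 2 * ‖constStack n d (avg n d (x' - x))‖ ^ 2) := by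
          gcongr
          exact (norm_centering_sq_le hn0 _).trans (norm_gradAvg_sub_sq_le hf _ _)
      _ = ℓ ^ 2 * ‖constStack n d (avg n d (gradStack f x))‖ ^ 2 := by
          rw [hx', sub_sub_cancel_left, map_neg, map_neg, norm_neg, map_smul, map_smul,
            avg_direction hn0 hA hv, norm_smul, mul_pow, Real.norm_eq_abs, sq_abs]
          field_simp
  have hstep := lyap_step_le hT hα.le hP.kappa1_le hP.beta_eq hP.gamma_pos hP.ell_pos.le
    hP.two_mul_ell_le hP.eps10_nonneg (hT.K_K x) (hT.K_K e) (hT.K_K (v + γ⁻¹ • gradAvg f x))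
    (norm_grad_discrepancy_sq_le hn0 hf x) hDle
  have hdir := hT.map_direction hP.gamma_pos.ne' β x e v (gradStack f x) (gradAvg f x)
  have hdual := dualError_step hn hA f α γ x x' v e
  rw [← hv'] at hdual
  rw [hD, smul_inv_smul₀ hα.ne', ← dualError, ← hdual, dualError, ← hdir, ← map_smul,
    ← map_sub, ← hx'] at hstep
  rw [show x - x' = α • direction (act (laplacian A)) β γ x e v (gradStack f x) by
    rw [hx', sub_sub_cancel]]
  have hE := mul_le_mul_of_nonneg_left (norm_centering_sq_le hn0 e) hP.alpha_mul_phi7_add_nonneg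
  simp only [dualError] at hstep ⊢
  linarith

lemma lyapunov_step_le_sub (hn : 2 ≤ n) (hA : IsUndirectedConnected A)
    (hf : ∀ i, IsSmoothWith ℓ (f i)) (hPL : PLCondition ν f)
    (hP : Admissible (rho (laplacian A)) (rho2 (laplacian A)) ℓ α β γ τ ω r δ)
    (hv : avg n d v = 0) {x' v' : AgentStack n d}
    (hx' : x' = x - α • direction (act (laplacian A)) β γ x e v (gradStack f x))
    (hv' : v' = v + (α * γ) • act (laplacian A) (x - e)) :
    lyapunov f A τ γ x' v' + eps10 ω r δ * ‖x - x'‖ ^ 2 ≤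
      lyapunov f A τ γ x v
        - α * eps3' (rho (laplacian A)) (rho2 (laplacian A)) ℓ α β γ ω r δ
          * (‖act (centering n) x‖ ^ 2
            + ⟪dualError f γ x v, act (laplacianPinv A) (dualError f γ x v)⟫_ℝ)
        - α * ν * gap f x
        + (α * phi7 (rho (laplacian A)) β γ
          + α ^ 2 * phi8' (rho (laplacian A)) (rho2 (laplacian A)) β γ ω r δ) * ‖e‖ ^ 2 := by
  have hn0 : 0 < n := by omega
  have hT := isPseudoInverse_laplacian (EuclideanSpace ℝ (Fin d)) hn hA
  have hα := hP.alpha_pos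
  have hlyap := lyap_dualError_step_le hn hA hf hP hv hx' hv'
  have hdiff : x - x' = α • direction (act (laplacian A)) β γ x e v (gradStack f x) := by
    rw [hx', sub_sub_cancel]
  have havg : avg n d x' = avg n d x - α • avg n d (gradStack f x) := by
    rw [hx', map_sub, map_smul, avg_direction hn0 hA hv]
  have hgap := gap_step_le hn0 hf hPL hα.le havg
  have hnorm : ‖x - x'‖ ^ 2 = ‖act (centering n) (x - x')‖ ^ 2
      + α ^ 2 * ‖constStack n d (avg n d (gradStack f x))‖ ^ 2 := by
    rw [hdiff, norm_smul_direction_sq hn0 hA hv, map_smul]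
  have hX := mul_le_mul_of_nonneg_right (eps3'_le_left (rho (laplacian A)) (rho2 (laplacian A))
    ℓ α β γ ω r δ) (mul_nonneg hα.le (sq_nonneg ‖act (centering n) x‖))
  have hW := mul_le_mul_of_nonneg_right (eps3'_le_right (rho (laplacian A)) (rho2 (laplacian A))
    ℓ α β γ ω r δ) (mul_nonneg hα.le (hT.inner_Q_nonneg (dualError f γ x v)))
  have hp : 0 ≤ α * (phi5 (rho2 (laplacian A)) ℓ β γ - α * phi6 (rho2 (laplacian A)) ℓ β γ
      + 3 / 8 - α * eps10 ω r δ) * ‖constStack n d (avg n d (gradStack f x))‖ ^ 2 :=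
    mul_nonneg (mul_nonneg hα.le (by linarith [hP.alpha_mul_phi6_lt, hP.alpha_mul_eps10_le]))
      (sq_nonneg _)
  simp only [lyapunov]
  rw [hnorm]
  linarith

lemma lyapunov_step_le (hn : 2 ≤ n) (hA : IsUndirectedConnected A)
    (hf : ∀ i, IsSmoothWith ℓ (f i)) (hbdd : BddBelow (Set.range (globalCost f)))
    (hν : 0 < ν) (hPL : PLCondition ν f)
    (hP : Admissible (rho (laplacian A)) (rho2 (laplacian A)) ℓ α β γ τ ω r δ)
    (hv : avg n d v = 0) {x' v' : AgentStack n d}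
    (hx' : x' = x - α • direction (act (laplacian A)) β γ x e v (gradStack f x))
    (hv' : v' = v + (α * γ) • act (laplacian A) (x - e)) :
    lyapunov f A τ γ x' v' + (1 - 2 * eps9 ω r δ) * ‖x' - (x - e)‖ ^ 2 ≤
      (1 - α * eps6' (rho (laplacian A)) (rho2 (laplacian A)) ℓ ν α β γ τ ω r δ) *
        (lyapunov f A τ γ x v + ‖e‖ ^ 2) := by
  have hT := isPseudoInverse_laplacian (EuclideanSpace ℝ (Fin d)) hn hA
  have hα := hP.alpha_pos
  have hκ := hP.eps6_pos hν
  have hstep := lyapunov_step_le_sub hn hA hf hPL hP hv hx' hv'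
  have herr := hP.eps9_mul_norm_sub_sq_le e (x - x')
  rw [show e - (x - x') = x' - (x - e) by abel] at herr
  have hlyap := lyap_le hT hP.tau_pos (act (centering n) x) (dualError f γ x v)
  have hXW := mul_le_mul_of_nonneg_left (hP.eps6_mul_eps2_le_eps3 ν) (mul_nonneg hα.le
    (add_nonneg (sq_nonneg ‖act (centering n) x‖) (hT.inner_Q_nonneg (dualError f γ x v))))
  have hlyap' := mul_le_mul_of_nonneg_left hlyap (mul_nonneg hα.le hκ.le)
  have hgap := mul_le_mul_of_nonneg_left (hP.eps6_le hν) (mul_nonneg hα.le (gap_nonneg hbdd x))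
  have he := mul_le_mul_of_nonneg_right (hP.alpha_mul_eps6_le hν) (sq_nonneg ‖e‖)
  rw [lyapunov] at hstep ⊢
  rw [lyapunov] at hstep ⊢
  linarith

end Descent

/-! ### The iterates -/

namespace State

variable {n d : ℕ}

/-- The stacked vector of the `x_i`. -/
def xs (S : State n d) : AgentStack n d := WithLp.toLp 2 S.x

/-- The stacked vector of the dual variables `v_i`. -/
def vs (S : State n d) : AgentStack n d := WithLp.toLp 2 S.v

/-- The stacked vector of the surrogates `x̂_i`. -/
def hs (S : State n d) : AgentStack n d := WithLp.toLp 2 S.xhat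

/-- The invariants of the algorithm: `y = L x̂`, and the dual variables have mean zero. -/
structure Invariant (L : Matrix (Fin n) (Fin n) ℝ) (S : State n d) : Prop where
  y_eq : ∀ i, S.y i = ∑ j, L i j • S.xhat j
  avg_vs : avg n d S.vs = 0

variable {f : Fin n → EuclideanSpace ℝ (Fin d) → ℝ} {L A : Matrix (Fin n) (Fin n) ℝ}
  {α β γ ω s : ℝ} {c : Fin n → EuclideanSpace ℝ (Fin d) → EuclideanSpace ℝ (Fin d)}
  {S : State n d}

lemma invariant_init (x0 : Fin n → EuclideanSpace ℝ (Fin d)) : (init x0).Invariant L where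
  y_eq i := by simp [init]
  avg_vs := by simp [init, vs, avg_apply]

lemma Invariant.y_step (hS : S.Invariant L) (i : Fin n) :
    (S.step f L α β γ ω s c).y i = ∑ j, L i j • (S.step f L α β γ ω s c).xhat j := by
  simp only [step, hS.y_eq, smul_add, Finset.sum_add_distrib, Finset.smul_sum,
    smul_comm (ω * s)]

lemma Invariant.vs_step (hS : S.Invariant L) :
    (S.step f L α β γ ω s c).vs = S.vs + (α * γ) • act L (S.step f L α β γ ω s c).hs := by
  ext1 i
  change S.v i + (α * γ) • (S.step f L α β γ ω s c).y i = _
  rw [hS.y_step]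
  rfl

lemma Invariant.xs_step (hS : S.Invariant L) :
    (S.step f L α β γ ω s c).xs = S.xs - α • (β • act L (S.step f L α β γ ω s c).hs
      + γ • S.vs + gradStack f S.xs) := by
  ext1 i
  change S.x i - α • (β • (S.step f L α β γ ω s c).y i + γ • S.v i + gradient (f i) (S.x i)) = _
  rw [hS.y_step]
  rfl

lemma xs_sub_hs_step (f : Fin n → EuclideanSpace ℝ (Fin d) → ℝ) (L : Matrix (Fin n) (Fin n) ℝ)
    (α β γ ω s : ℝ) (c : Fin n → EuclideanSpace ℝ (Fin d) → EuclideanSpace ℝ (Fin d))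
    (S : State n d) :
    S.xs - (S.step f L α β γ ω s c).hs =
      WithLp.toLp 2 fun i => (S.xs - S.hs) i - (ω * s) • c i (s⁻¹ • (S.xs - S.hs) i) := by
  ext1 i
  exact (sub_sub _ _ _).symm

lemma Invariant.step (hn : 0 < n) (hA : IsUndirectedConnected A)
    (hS : S.Invariant (laplacian A)) :
    (S.step f (laplacian A) α β γ ω s c).Invariant (laplacian A) where
  y_eq := hS.y_step
  avg_vs := by
    rw [hS.vs_step, map_add, map_smul, avg_act_laplacian hn hA, hS.avg_vs, smul_zero, add_zero]

lemma invariant_run (hn : 0 < n) (hA : IsUndirectedConnected A)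
    (f : Fin n → EuclideanSpace ℝ (Fin d) → ℝ) (α β γ ω : ℝ) (s : ℕ → ℝ) {Z : Type*}
    (𝒞 : Z → EuclideanSpace ℝ (Fin d) → EuclideanSpace ℝ (Fin d))
    (x0 : Fin n → EuclideanSpace ℝ (Fin d)) (z : Fin n → ℕ → Z) (k : ℕ) :
    (run f (laplacian A) α β γ ω s 𝒞 x0 z k).Invariant (laplacian A) := by
  induction k with
  | zero => exact invariant_init x0
  | succ k ih => exact ih.step hn hA

/-- The Lyapunov function of the algorithm: `lyapunov` plus `c` times the squared compression
error. -/
def energy (f : Fin n → EuclideanSpace ℝ (Fin d) → ℝ) (A : Matrix (Fin n) (Fin n) ℝ)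
    (τ γ c : ℝ) (S : State n d) : ℝ :=
  lyapunov f A τ γ S.xs S.vs + c * ‖S.xs - S.hs‖ ^ 2

variable {ℓ ν τ r δ : ℝ}

lemma Invariant.energy_step_le (hn : 2 ≤ n) (hA : IsUndirectedConnected A)
    (hf : ∀ i, IsSmoothWith ℓ (f i)) (hbdd : BddBelow (Set.range (globalCost f)))
    (hν : 0 < ν) (hPL : PLCondition ν f)
    (hP : Admissible (rho (laplacian A)) (rho2 (laplacian A)) ℓ α β γ τ ω r δ)
    (hS : S.Invariant (laplacian A)) :
    (S.step f (laplacian A) α β γ ω s c).energy f A τ γ (1 - 2 * eps9 ω r δ) ≤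
      (1 - α * eps6' (rho (laplacian A)) (rho2 (laplacian A)) ℓ ν α β γ τ ω r δ) *
        (lyapunov f A τ γ S.xs S.vs
          + ‖S.xs - (S.step f (laplacian A) α β γ ω s c).hs‖ ^ 2) := by
  have hstep := lyapunov_step_le hn hA hf hbdd hν hPL hP (x := S.xs)
    (e := S.xs - (S.step f (laplacian A) α β γ ω s c).hs) hS.avg_vs
    (hS.xs_step.trans (by rw [direction, sub_sub_cancel]))
    (hS.vs_step.trans (by rw [sub_sub_cancel]))
  rwa [sub_sub_cancel] at hstep

lemma mul_performance (hn : 0 < n) (f : Fin n → EuclideanSpace ℝ (Fin d) → ℝ) (S : State n d) :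
    n * performance f S.x = gap f S.xs + ‖act (centering n) S.xs‖ ^ 2 := by
  have hn' : (n : ℝ) ≠ 0 := Nat.cast_ne_zero.mpr hn.ne'
  rw [act_centering, PiLp.norm_sq_eq_of_L2, gap, performance, mul_add, ← mul_assoc _ (1 / (n : ℝ)),
    mul_one_div_cancel hn', one_mul]
  rfl

lemma lyapunov_nonneg (hn : 2 ≤ n) (hA : IsUndirectedConnected A)
    (hbdd : BddBelow (Set.range (globalCost f))) (hτ : 4 / rho2 (laplacian A) ≤ τ)
    (γ : ℝ) (x v : AgentStack n d) : 0 ≤ lyapunov f A τ γ x v :=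
  add_nonneg (le_trans (by positivity)
    (le_lyap (isPseudoInverse_laplacian (EuclideanSpace ℝ (Fin d)) hn hA) hτ _ _))
    (gap_nonneg hbdd x)

lemma performance_le_energy (hn : 2 ≤ n) (hA : IsUndirectedConnected A)
    (hbdd : BddBelow (Set.range (globalCost f))) (hτ : 4 / rho2 (laplacian A) ≤ τ)
    (γ : ℝ) {c : ℝ} (hc : 0 ≤ c) (S : State n d) :
    performance f S.x ≤ 4 / n * S.energy f A τ γ c := by
  have hn' : (0 : ℝ) < n := Nat.cast_pos.mpr (by omega)
  have hlyap := le_lyap (isPseudoInverse_laplacian (EuclideanSpace ℝ (Fin d)) hn hA) hτ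
    (act (centering n) S.xs) (dualError f γ S.xs S.vs)
  have herr : 0 ≤ c * ‖S.xs - S.hs‖ ^ 2 := by positivity
  rw [div_mul_eq_mul_div, le_div_iff₀' hn', S.mul_performance (by omega), energy, lyapunov]
  linarith [gap_nonneg hbdd S.xs]

end State

lemma performance_nonneg {n d : ℕ} {f : Fin n → EuclideanSpace ℝ (Fin d) → ℝ}
    (hbdd : BddBelow (Set.range (globalCost f))) (x : Fin n → EuclideanSpace ℝ (Fin d)) :
    0 ≤ performance f x :=
  add_nonneg (sub_nonneg.mpr (ciInf_le hbdd _))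
    (mul_nonneg (by positivity) (Finset.sum_nonneg fun _ _ => sq_nonneg _))

/-! ### Measurability of the iterates -/

section Measurability

variable {n d : ℕ} {f : Fin n → EuclideanSpace ℝ (Fin d) → ℝ} {ℓ : ℝ}

/-- The σ-algebra generated by the four components of a state. -/
instance : MeasurableSpace (State n d) :=
  MeasurableSpace.comap (fun S => (S.x, S.v, S.xhat, S.y)) inferInstance

namespace State

lemma measurable_components :
    Measurable fun S : State n d => (S.x, S.v, S.xhat, S.y) :=
  comap_measurable _

@[fun_prop]
lemma measurable_x : Measurable (x : State n d → _) := measurable_components.fst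

@[fun_prop]
lemma measurable_v : Measurable (v : State n d → _) := measurable_components.snd.fst

@[fun_prop]
lemma measurable_xhat : Measurable (xhat : State n d → _) := measurable_components.snd.snd.fst

@[fun_prop]
lemma measurable_y : Measurable (y : State n d → _) := measurable_components.snd.snd.snd

@[fun_prop]
lemma measurable_xs : Measurable (xs : State n d → AgentStack n d) :=
  (WithLp.measurable_toLp 2 _).comp measurable_x

@[fun_prop]
lemma measurable_vs : Measurable (vs : State n d → AgentStack n d) :=
  (WithLp.measurable_toLp 2 _).comp measurable_v

@[fun_prop]
lemma measurable_hs : Measurable (hs : State n d → AgentStack n d) :=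
  (WithLp.measurable_toLp 2 _).comp measurable_xhat

variable {Z : Type*} [MeasurableSpace Z]
  {𝒞 : Z → EuclideanSpace ℝ (Fin d) → EuclideanSpace ℝ (Fin d)}

lemma measurable_step (hf : ∀ i, IsSmoothWith ℓ (f i)) (L : Matrix (Fin n) (Fin n) ℝ)
    (α β γ ω s : ℝ) (h𝒞 : Measurable fun p : Z × EuclideanSpace ℝ (Fin d) => 𝒞 p.1 p.2) :
    Measurable fun p : State n d × (Fin n → Z) =>
      p.1.step f L α β γ ω s fun i => 𝒞 (p.2 i) := by
  have (i : Fin n) : Measurable fun p : State n d × (Fin n → Z) =>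
      𝒞 (p.2 i) (s⁻¹ • (p.1.x i - p.1.xhat i)) :=
    h𝒞.comp (f := fun p : State n d × (Fin n → Z) => (p.2 i, s⁻¹ • (p.1.x i - p.1.xhat i)))
      (by fun_prop)
  have hgrad (i : Fin n) : Measurable (gradient (f i)) := (hf i).continuous_gradient.measurable
  refine measurable_comap_iff.mpr ?_
  simp only [Function.comp_def, step]
  fun_prop

end State

variable {Z Ω : Type*} [MeasurableSpace Z] [MeasurableSpace Ω]
  {𝒞 : Z → EuclideanSpace ℝ (Fin d) → EuclideanSpace ℝ (Fin d)}

lemma measurable_run (hf : ∀ i, IsSmoothWith ℓ (f i)) (L : Matrix (Fin n) (Fin n) ℝ)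
    (α β γ ω : ℝ) (s : ℕ → ℝ)
    (h𝒞 : Measurable fun p : Z × EuclideanSpace ℝ (Fin d) => 𝒞 p.1 p.2)
    (x0 : Fin n → EuclideanSpace ℝ (Fin d)) {ζ : Fin n → ℕ → Ω → Z} {k : ℕ}
    (hζ : ∀ i, ∀ t < k, Measurable (ζ i t)) :
    Measurable fun a => run f L α β γ ω s 𝒞 x0 (fun i t => ζ i t a) k := by
  induction k with
  | zero => exact measurable_const
  | succ k ih =>
    exact (State.measurable_step hf L α β γ ω (s k) h𝒞).comp
      ((ih fun i t ht => hζ i t (ht.trans k.lt_succ_self)).prodMk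
        (measurable_pi_lambda _ fun i => hζ i k k.lt_succ_self))

lemma IsCompressionNoise.indepFun_run {μ : Measure Ω} {P : Measure Z} {ζ : Fin n → ℕ → Ω → Z}
    (hζ : IsCompressionNoise μ P ζ) (hf : ∀ i, IsSmoothWith ℓ (f i))
    (L : Matrix (Fin n) (Fin n) ℝ) (α β γ ω : ℝ) (s : ℕ → ℝ)
    (h𝒞 : Measurable fun p : Z × EuclideanSpace ℝ (Fin d) => 𝒞 p.1 p.2)
    (x0 : Fin n → EuclideanSpace ℝ (Fin d)) (i : Fin n) (k : ℕ) :
    IndepFun (ζ i k) (fun a => run f L α β γ ω s 𝒞 x0 (fun i t => ζ i t a) k) μ := by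
  have hpast : Measurable[MeasurableSpace.comap (fun a (j : Fin n) (t : Fin k) => ζ j t a)
      inferInstance] fun a => run f L α β γ ω s 𝒞 x0 (fun i t => ζ i t a) k := by
    refine @measurable_run _ _ _ _ _ _ _ (_) _ hf L α β γ ω s h𝒞 x0 _ _ fun j t ht => ?_
    have hcoord : Measurable fun h : Fin n → Fin k → Z => h j ⟨t, ht⟩ := by fun_prop
    exact hcoord.comp (comap_measurable _)
  exact (IndepFun_iff_Indep _ _ _).mpr
    (indep_of_indep_of_le_right ((IndepFun_iff_Indep _ _ _).mp (hζ.indep i k)) hpast.comap_le)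

lemma continuous_avg : Continuous fun x : AgentStack n d => avg n d x := by
  change Continuous fun x : AgentStack n d => (1 / (n : ℝ)) • ∑ i, x i
  fun_prop

lemma continuous_constStack : Continuous fun u => constStack n d u :=
  (PiLp.continuous_toLp 2 _).comp (by fun_prop)

lemma continuous_act (M : Matrix (Fin n) (Fin n) ℝ) :
    Continuous fun x : AgentStack n d => act M x := by
  change Continuous fun x : AgentStack n d => WithLp.toLp 2 fun i => ∑ j, M i j • x j
  fun_prop

lemma continuous_globalCost (hf : ∀ i, IsSmoothWith ℓ (f i)) : Continuous (globalCost f) :=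
  (continuous_finsetSum _ fun i _ => (hf i).1.continuous).const_mul _

lemma continuous_gradStack (hf : ∀ i, IsSmoothWith ℓ (f i)) : Continuous (gradStack f) := by
  have hgrad (i : Fin n) : Continuous (gradient (f i)) := (hf i).continuous_gradient
  unfold gradStack
  fun_prop

lemma continuous_gap (hf : ∀ i, IsSmoothWith ℓ (f i)) :
    Continuous (gap f : AgentStack n d → ℝ) :=
  (((continuous_globalCost hf).comp continuous_avg).sub continuous_const).const_mul _

lemma continuous_dualError (hf : ∀ i, IsSmoothWith ℓ (f i)) (γ : ℝ) :
    Continuous fun p : AgentStack n d × AgentStack n d => dualError f γ p.1 p.2 := by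
  have hgrad : Continuous (gradAvg f : AgentStack n d → AgentStack n d) :=
    (continuous_gradStack hf).comp (continuous_constStack.comp continuous_avg)
  exact (continuous_act _).comp
    (continuous_snd.add ((hgrad.comp continuous_fst).fun_const_smul γ⁻¹))

lemma continuous_lyap {V : Type*} [NormedAddCommGroup V] [InnerProductSpace ℝ V]
    {Q : V →ₗ[ℝ] V} (hQ : Continuous Q) (τ : ℝ) :
    Continuous fun p : V × V => lyap Q τ p.1 p.2 := by
  have : Continuous fun p : V × V => Q p.2 := hQ.comp continuous_snd
  unfold lyap
  fun_prop

lemma continuous_lyapunov (hf : ∀ i, IsSmoothWith ℓ (f i)) (A : Matrix (Fin n) (Fin n) ℝ)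
    (τ γ : ℝ) : Continuous fun p : AgentStack n d × AgentStack n d =>
      lyapunov f A τ γ p.1 p.2 := by
  have hlyap := (continuous_lyap (continuous_act (d := d) (laplacianPinv A)) τ).comp
    (((continuous_act (centering n)).comp continuous_fst).prodMk (continuous_dualError hf γ))
  exact hlyap.add ((continuous_gap hf).comp continuous_fst)

lemma continuous_performance (hf : ∀ i, IsSmoothWith ℓ (f i)) : Continuous (performance f) := by
  have hcost := continuous_globalCost hf
  unfold performance average
  fun_prop

end Measurability

/-! ### The compression error -/

section Compression

variable {n d : ℕ} {Z Ω : Type*} [MeasurableSpace Z] {P : Measure Z}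
  {𝒞 : Z → EuclideanSpace ℝ (Fin d) → EuclideanSpace ℝ (Fin d)} {r δ C ω s : ℝ}

lemma norm_sub_smul_sq_le {V : Type*} [NormedAddCommGroup V] [NormedSpace ℝ V] (hr : 0 < r)
    (hω : ω ∈ Set.Ioc (0 : ℝ) (1 / r)) (hs : 0 < s) (u q : V) :
    ‖u - (ω * s) • q‖ ^ 2 ≤
      (1 - ω * r) * ‖u‖ ^ 2 + ω * r * s ^ 2 * ‖r⁻¹ • q - s⁻¹ • u‖ ^ 2 := by
  have hsplit : u - (ω * s) • q = (1 - ω * r) • u + (ω * r) • -(s • (r⁻¹ • q - s⁻¹ • u)) := by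
    match_scalars
    · field_simp
      ring
    · field_simp
  have hconv := ((convexOn_univ_norm (E := V)).pow (fun _ _ => norm_nonneg _) 2).2
    (Set.mem_univ u) (Set.mem_univ (-(s • (r⁻¹ • q - s⁻¹ • u))))
    (sub_nonneg.mpr ((le_div_iff₀ hr).mp hω.2)) (mul_pos hω.1 hr).le (sub_add_cancel _ _)
  simp only [Pi.pow_apply, ← hsplit, norm_neg, norm_smul, smul_eq_mul, mul_pow,
    Real.norm_eq_abs, sq_abs] at hconv
  linarith

variable [MeasurableSpace Ω] {μ : Measure Ω}

lemma lintegral_le_of_indepFun {T : Type*} [MeasurableSpace T] [SFinite P] {ζ : Ω → Z}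
    {U : Ω → T} [IsFiniteMeasure μ] (hζ : MeasurePreserving ζ μ P) (hU : Measurable U)
    (hind : IndepFun ζ U μ) {F : Z × T → ENNReal} (hF : Measurable F) {B : T → ENNReal}
    (hB : Measurable B) (hFB : ∀ t, ∫⁻ z, F (z, t) ∂P ≤ B t) :
    ∫⁻ a, F (ζ a, U a) ∂μ ≤ ∫⁻ a, B (U a) ∂μ := by
  have hmap := (indepFun_iff_map_prod_eq_prod_map_map hζ.measurable.aemeasurable
    hU.aemeasurable).mp hind
  rw [hζ.map_eq] at hmap
  rw [← lintegral_map hF (hζ.measurable.prodMk hU), hmap, lintegral_prod_symm' _ hF,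
    ← lintegral_map hB hU]
  exact lintegral_mono hFB

lemma lintegral_norm_stack_sq {U : Ω → AgentStack n d} (hU : ∀ i, Measurable fun a => U a i) :
    ∫⁻ a, ENNReal.ofReal (‖U a‖ ^ 2) ∂μ = ∑ i, ∫⁻ a, ENNReal.ofReal (‖U a i‖ ^ 2) ∂μ := by
  rw [← lintegral_finsetSum _ fun i _ => ((hU i).norm.pow_const 2).ennreal_ofReal]
  refine lintegral_congr fun a => ?_
  rw [PiLp.norm_sq_eq_of_L2, ENNReal.ofReal_sum_of_nonneg fun i _ => sq_nonneg _]

variable [IsProbabilityMeasure P]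

lemma lintegral_compression_le (hr : 0 < r) (h𝒞 : GloballyBounded P 𝒞 r δ C)
    (hω : ω ∈ Set.Ioc (0 : ℝ) (1 / r)) (hs : 0 < s) (u : EuclideanSpace ℝ (Fin d)) :
    ∫⁻ z, ENNReal.ofReal (‖u - (ω * s) • 𝒞 z (s⁻¹ • u)‖ ^ 2) ∂P ≤
      ENNReal.ofReal (1 - 2 * eps9 ω r δ) * ENNReal.ofReal (‖u‖ ^ 2)
        + ENNReal.ofReal (ω * r * C * s ^ 2) := by
  have hωr : 0 ≤ 1 - ω * r := sub_nonneg.mpr ((le_div_iff₀ hr).mp hω.2)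
  have hωr₀ : 0 < ω * r := mul_pos hω.1 hr
  have hint := (h𝒞.integrable (s⁻¹ • u)).const_mul (ω * r * s ^ 2)
  have hint' : Integrable (fun z => (1 - ω * r) * ‖u‖ ^ 2
      + ω * r * s ^ 2 * ‖r⁻¹ • 𝒞 z (s⁻¹ • u) - s⁻¹ • u‖ ^ 2) P := (integrable_const _).add hint
  have hbound := mul_le_mul_of_nonneg_left (h𝒞.bound (s⁻¹ • u))
    (by positivity : 0 ≤ ω * r * s ^ 2)
  calc ∫⁻ z, ENNReal.ofReal (‖u - (ω * s) • 𝒞 z (s⁻¹ • u)‖ ^ 2) ∂P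
      ≤ ∫⁻ z, ENNReal.ofReal ((1 - ω * r) * ‖u‖ ^ 2
          + ω * r * s ^ 2 * ‖r⁻¹ • 𝒞 z (s⁻¹ • u) - s⁻¹ • u‖ ^ 2) ∂P :=
        lintegral_mono fun z => ENNReal.ofReal_le_ofReal (norm_sub_smul_sq_le hr hω hs _ _)
    _ = ENNReal.ofReal ((1 - ω * r) * ‖u‖ ^ 2
          + ω * r * s ^ 2 * ∫ z, ‖r⁻¹ • 𝒞 z (s⁻¹ • u) - s⁻¹ • u‖ ^ 2 ∂P) := by
        rw [← ofReal_integral_eq_lintegral_ofReal hint'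
          (ae_of_all _ fun z => by positivity), integral_add (integrable_const _) hint,
          integral_const, integral_const_mul, probReal_univ, one_smul]
    _ ≤ ENNReal.ofReal ((1 - 2 * eps9 ω r δ) * ‖u‖ ^ 2 + ω * r * C * s ^ 2) := by
        refine ENNReal.ofReal_le_ofReal ((add_le_add_right hbound _).trans_eq ?_)
        rw [norm_smul, mul_pow, Real.norm_eq_abs, sq_abs, eps9]
        field_simp
        ring
    _ ≤ _ := by
        rw [← ENNReal.ofReal_mul' (sq_nonneg _)]
        exact ENNReal.ofReal_add_le

variable [IsProbabilityMeasure μ]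

lemma lintegral_compression_comp_le (hr : 0 < r) (h𝒞 : GloballyBounded P 𝒞 r δ C)
    (hω : ω ∈ Set.Ioc (0 : ℝ) (1 / r)) (hs : 0 < s) {ζ : Ω → Z}
    {U : Ω → EuclideanSpace ℝ (Fin d)} (hζ : MeasurePreserving ζ μ P) (hU : Measurable U)
    (hind : IndepFun ζ U μ) :
    ∫⁻ a, ENNReal.ofReal (‖U a - (ω * s) • 𝒞 (ζ a) (s⁻¹ • U a)‖ ^ 2) ∂μ ≤
      ENNReal.ofReal (1 - 2 * eps9 ω r δ) * ∫⁻ a, ENNReal.ofReal (‖U a‖ ^ 2) ∂μ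
        + ENNReal.ofReal (ω * r * C * s ^ 2) := by
  have hq : Measurable fun p : Z × EuclideanSpace ℝ (Fin d) => 𝒞 p.1 (s⁻¹ • p.2) :=
    h𝒞.measurable.comp (f := fun p : Z × EuclideanSpace ℝ (Fin d) => (p.1, s⁻¹ • p.2))
      (by fun_prop)
  refine (lintegral_le_of_indepFun hζ hU hind
    (F := fun p => ENNReal.ofReal (‖p.2 - (ω * s) • 𝒞 p.1 (s⁻¹ • p.2)‖ ^ 2))
    ((measurable_snd.sub (hq.fun_const_smul _)).norm.pow_const 2).ennreal_ofReal
    (by fun_prop) (lintegral_compression_le hr h𝒞 hω hs)).trans_eq ?_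
  rw [lintegral_add_right _ measurable_const, lintegral_const_mul _ (by fun_prop),
    lintegral_const, measure_univ, mul_one]

lemma lintegral_stack_compression_le (hr : 0 < r) (h𝒞 : GloballyBounded P 𝒞 r δ C)
    (hω : ω ∈ Set.Ioc (0 : ℝ) (1 / r)) (hs : 0 < s) {ζ : Fin n → Ω → Z}
    {U : Ω → AgentStack n d} (hζ : ∀ i, MeasurePreserving (ζ i) μ P) (hU : Measurable U)
    (hind : ∀ i, IndepFun (ζ i) U μ) :
    ∫⁻ a, ENNReal.ofReal (‖WithLp.toLp 2 fun i =>
        U a i - (ω * s) • 𝒞 (ζ i a) (s⁻¹ • U a i)‖ ^ 2) ∂μ ≤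
      ENNReal.ofReal (1 - 2 * eps9 ω r δ) * ∫⁻ a, ENNReal.ofReal (‖U a‖ ^ 2) ∂μ
        + n * ENNReal.ofReal (ω * r * C * s ^ 2) := by
  have hcoord (i : Fin n) : Measurable fun x : AgentStack n d => x i := by fun_prop
  have hUi (i : Fin n) : Measurable fun a => U a i := (hcoord i).comp hU
  have hq (i : Fin n) : Measurable fun a => 𝒞 (ζ i a) (s⁻¹ • U a i) :=
    h𝒞.measurable.comp ((hζ i).measurable.prodMk ((hUi i).fun_const_smul s⁻¹))
  rw [lintegral_norm_stack_sq fun i => (hUi i).sub ((hq i).fun_const_smul _),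
    lintegral_norm_stack_sq hUi]
  refine (Finset.sum_le_sum fun i _ => lintegral_compression_comp_le hr h𝒞 hω hs (hζ i) (hUi i)
    ((hind i).comp measurable_id (hcoord i))).trans_eq ?_
  rw [Finset.sum_add_distrib, ← Finset.mul_sum, Finset.sum_const, Finset.card_univ,
    Fintype.card_fin, nsmul_eq_mul]

end Compression

/-! ### Linear convergence -/

section Convergence

lemma le_add_mul_mul_pow {R : Type*} [CommSemiring R] [PartialOrder R] [IsOrderedRing R]
    {V : ℕ → R} {q M : R} (hq : 0 ≤ q) (hV : ∀ k, V (k + 1) ≤ q * (V k + M * q ^ k)) (k : ℕ) :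
    V k ≤ (V 0 + k * M) * q ^ k := by
  induction k with
  | zero => simp
  | succ k ih =>
    calc V (k + 1) ≤ q * (V k + M * q ^ k) := hV k
      _ ≤ q * ((V 0 + k * M) * q ^ k + M * q ^ k) := by gcongr
      _ = (V 0 + (k + 1 : ℕ) * M) * q ^ (k + 1) := by push_cast; ring

lemma isBigO_add_mul_mul_pow {q q' : ℝ} (hq : 0 ≤ q) (hqq' : q < q') (a b : ℝ) :
    (fun k : ℕ => (a + k * b) * q ^ k) =O[atTop] fun k : ℕ => q' ^ k := by
  have hlt : ‖q‖ < q' := by rwa [Real.norm_of_nonneg hq]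
  have hconst := (isLittleO_pow_const_mul_const_pow_const_pow_of_norm_lt 0 hlt).isBigO
  have hlinear := (isLittleO_pow_const_mul_const_pow_const_pow_of_norm_lt 1 hlt).isBigO
  refine ((hconst.const_mul_left a).add (hlinear.const_mul_left b)).congr_left fun k => ?_
  ring

variable {Ω : Type*} [MeasurableSpace Ω] {μ : Measure Ω}

lemma integrable_and_isBigO_pow_of_lintegral_le {u : ℕ → Ω → ℝ}
    (hu : ∀ k, AEStronglyMeasurable (u k) μ) (hu₀ : ∀ k a, 0 ≤ u k a) {a b : NNReal} {q : ℝ}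
    (hq : 0 ≤ q)
    (h : ∀ k : ℕ, ∫⁻ ω, ENNReal.ofReal (u k ω) ∂μ ≤ (a + k * b) * ENNReal.ofReal q ^ k) :
    (∀ k, Integrable (u k) μ) ∧
      ∀ q' > q, (fun k => ∫ ω, u k ω ∂μ) =O[atTop] fun k : ℕ => q' ^ k := by
  have hofReal (k : ℕ) : (a + k * b) * ENNReal.ofReal q ^ k =
      ENNReal.ofReal ((a + k * b) * q ^ k) := by
    rw [ENNReal.ofReal_mul (by positivity), ENNReal.ofReal_pow hq,
      ENNReal.ofReal_add (by positivity) (by positivity), ENNReal.ofReal_mul (by positivity),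
      ENNReal.ofReal_coe_nnreal, ENNReal.ofReal_coe_nnreal, ENNReal.ofReal_natCast]
  simp only [hofReal] at h
  refine ⟨fun k => (lintegral_ofReal_ne_top_iff_integrable (hu k) (ae_of_all _ (hu₀ k))).mp
    ((h k).trans_lt ENNReal.ofReal_lt_top).ne, fun q' hq' => ?_⟩
  refine (Asymptotics.IsBigO.of_norm_le fun k => ?_).trans (isBigO_add_mul_mul_pow hq hq' a b)
  rw [Real.norm_of_nonneg (integral_nonneg (hu₀ k)),
    integral_eq_lintegral_of_nonneg_ae (ae_of_all _ (hu₀ k)) (hu k)]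
  exact ENNReal.toReal_le_of_le_ofReal (by positivity) (h k)

lemma lintegral_ofReal_le_of_le_mul_add {E W N N' : Ω → ℝ} {κ c : ℝ} {B : ENNReal}
    (hW : Measurable W) (hW₀ : ∀ a, 0 ≤ W a) (hN : ∀ a, 0 ≤ N a) (hN' : ∀ a, 0 ≤ N' a)
    (hc : 0 ≤ c) (hE : ∀ a, E a ≤ κ * (W a + N' a))
    (hN'N : ∫⁻ a, ENNReal.ofReal (N' a) ∂μ ≤
      ENNReal.ofReal c * ∫⁻ a, ENNReal.ofReal (N a) ∂μ + B) :
    ∫⁻ a, ENNReal.ofReal (E a) ∂μ ≤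
      ENNReal.ofReal κ * (∫⁻ a, ENNReal.ofReal (W a + c * N a) ∂μ + B) := by
  have hsplit : ∫⁻ a, ENNReal.ofReal (W a + c * N a) ∂μ =
      ∫⁻ a, ENNReal.ofReal (W a) ∂μ + ENNReal.ofReal c * ∫⁻ a, ENNReal.ofReal (N a) ∂μ := by
    rw [← lintegral_const_mul' _ _ ENNReal.ofReal_ne_top,
      ← lintegral_add_left hW.ennreal_ofReal]
    refine lintegral_congr fun a => ?_
    rw [ENNReal.ofReal_add (hW₀ a) (mul_nonneg hc (hN a)), ENNReal.ofReal_mul hc]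
  calc ∫⁻ a, ENNReal.ofReal (E a) ∂μ
      ≤ ∫⁻ a, ENNReal.ofReal κ * (ENNReal.ofReal (W a) + ENNReal.ofReal (N' a)) ∂μ := by
        refine lintegral_mono fun a => ?_
        rw [← ENNReal.ofReal_add (hW₀ a) (hN' a),
          ← ENNReal.ofReal_mul' (add_nonneg (hW₀ a) (hN' a))]
        exact ENNReal.ofReal_le_ofReal (hE a)
    _ = ENNReal.ofReal κ *
        (∫⁻ a, ENNReal.ofReal (W a) ∂μ + ∫⁻ a, ENNReal.ofReal (N' a) ∂μ) := by
        rw [lintegral_const_mul' _ _ ENNReal.ofReal_ne_top,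
          lintegral_add_left hW.ennreal_ofReal]
    _ ≤ _ := by
        rw [hsplit, add_assoc]
        gcongr

variable [IsProbabilityMeasure μ] {n d : ℕ} {A : Matrix (Fin n) (Fin n) ℝ}
  {f : Fin n → EuclideanSpace ℝ (Fin d) → ℝ} {Z : Type*} [MeasurableSpace Z]
  {P : Measure Z} [IsProbabilityMeasure P]
  {𝒞 : Z → EuclideanSpace ℝ (Fin d) → EuclideanSpace ℝ (Fin d)}
  {ℓ ν α β γ τ ω r δ C : ℝ}

lemma lintegral_energy_step_le (hn : 2 ≤ n) (hA : IsUndirectedConnected A)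
    (hf : ∀ i, IsSmoothWith ℓ (f i)) (hbdd : BddBelow (Set.range (globalCost f)))
    (hν : 0 < ν) (hPL : PLCondition ν f)
    (hP : Admissible (rho (laplacian A)) (rho2 (laplacian A)) ℓ α β γ τ ω r δ)
    (h𝒞 : GloballyBounded P 𝒞 r δ C) {s : ℝ} (hs : 0 < s) {ζ : Fin n → Ω → Z}
    (hζ : ∀ i, MeasurePreserving (ζ i) μ P) {S : Ω → State n d} (hS : Measurable S)
    (hind : ∀ i, IndepFun (ζ i) S μ) (hinv : ∀ a, (S a).Invariant (laplacian A)) :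
    ∫⁻ a, ENNReal.ofReal (((S a).step f (laplacian A) α β γ ω s fun i => 𝒞 (ζ i a)).energy
        f A τ γ (1 - 2 * eps9 ω r δ)) ∂μ ≤
      ENNReal.ofReal
          (1 - α * eps6' (rho (laplacian A)) (rho2 (laplacian A)) ℓ ν α β γ τ ω r δ) *
        (∫⁻ a, ENNReal.ofReal ((S a).energy f A τ γ (1 - 2 * eps9 ω r δ)) ∂μ
          + n * ENNReal.ofReal (ω * r * C * s ^ 2)) := by
  have hpair : Measurable fun a => ((S a).xs, (S a).vs) :=
    (State.measurable_xs.comp hS).prodMk (State.measurable_vs.comp hS)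
  have hlyap := (continuous_lyapunov hf A τ γ).measurable.comp hpair
  have herr := State.measurable_xs.sub (State.measurable_hs (n := n) (d := d))
  refine lintegral_ofReal_le_of_le_mul_add hlyap
    (fun a => State.lyapunov_nonneg hn hA hbdd hP.kappa1_le γ _ _) (fun a => sq_nonneg _)
    (fun a => sq_nonneg _) (sub_nonneg.mpr hP.two_mul_eps9_le_one)
    (fun a => (hinv a).energy_step_le hn hA hf hbdd hν hPL hP) ?_
  simp only [State.xs_sub_hs_step]
  exact lintegral_stack_compression_le hP.r_pos h𝒞 hP.omega_mem hs hζ (herr.comp hS) fun i =>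
    (hind i).comp measurable_id herr

variable {ζ : Fin n → ℕ → Ω → Z} {ε s₀ q : ℝ}

lemma lintegral_energy_run_le (hn : 2 ≤ n) (hA : IsUndirectedConnected A)
    (hf : ∀ i, IsSmoothWith ℓ (f i)) (hbdd : BddBelow (Set.range (globalCost f)))
    (hν : 0 < ν) (hPL : PLCondition ν f)
    (hP : Admissible (rho (laplacian A)) (rho2 (laplacian A)) ℓ α β γ τ ω r δ)
    (h𝒞 : GloballyBounded P 𝒞 r δ C) (hζ : IsCompressionNoise μ P ζ)
    (x0 : Fin n → EuclideanSpace ℝ (Fin d)) (hε : 0 < ε) (hs₀ : 0 < s₀)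
    (hq : 1 - α * eps6' (rho (laplacian A)) (rho2 (laplacian A)) ℓ ν α β γ τ ω r δ ≤ q)
    (hεq : ε ^ 2 ≤ q) (k : ℕ) :
    ∫⁻ a, ENNReal.ofReal ((run f (laplacian A) α β γ ω (fun k => s₀ * ε ^ k) 𝒞 x0
        (fun i t => ζ i t a) k).energy f A τ γ (1 - 2 * eps9 ω r δ)) ∂μ ≤
      (ENNReal.ofReal ((State.init x0).energy f A τ γ (1 - 2 * eps9 ω r δ))
        + k * (n * ENNReal.ofReal (ω * r * C * s₀ ^ 2))) * ENNReal.ofReal q ^ k := by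
  set S := fun k a => run f (laplacian A) α β γ ω (fun k => s₀ * ε ^ k) 𝒞 x0
    (fun i t => ζ i t a) k
  have hnoise (k : ℕ) : ENNReal.ofReal (ω * r * C * (s₀ * ε ^ k) ^ 2) ≤
      ENNReal.ofReal (ω * r * C * s₀ ^ 2) * ENNReal.ofReal q ^ k := by
    rw [mul_pow, ← mul_assoc, pow_right_comm, ENNReal.ofReal_mul' (by positivity),
      ENNReal.ofReal_pow (sq_nonneg ε)]
    gcongr
  have hrec := le_add_mul_mul_pow (q := ENNReal.ofReal q) zero_le
    (V := fun k => ∫⁻ a, ENNReal.ofReal ((S k a).energy f A τ γ (1 - 2 * eps9 ω r δ)) ∂μ)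
    (M := n * ENNReal.ofReal (ω * r * C * s₀ ^ 2)) (fun k => ?_) k
  · have hinit : ∫⁻ a, ENNReal.ofReal ((S 0 a).energy f A τ γ (1 - 2 * eps9 ω r δ)) ∂μ =
        ENNReal.ofReal ((State.init x0).energy f A τ γ (1 - 2 * eps9 ω r δ)) := by
      simp only [S, run, lintegral_const, measure_univ, mul_one]
    rwa [hinit] at hrec
  · refine (lintegral_energy_step_le hn hA hf hbdd hν hPL hP h𝒞 (by positivity)
      (fun i => hζ.law i k)
      (measurable_run hf _ α β γ ω _ h𝒞.measurable x0 fun i t _ => (hζ.law i t).measurable)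
      (fun i => hζ.indepFun_run hf _ α β γ ω _ h𝒞.measurable x0 i k)
      fun a => State.invariant_run (by omega) hA f α β γ ω _ 𝒞 x0 _ k).trans ?_
    rw [mul_assoc (n : ENNReal)]
    gcongr
    exact hnoise k

lemma exists_lintegral_performance_run_le (hn : 2 ≤ n) (hA : IsUndirectedConnected A)
    (hf : ∀ i, IsSmoothWith ℓ (f i)) (hbdd : BddBelow (Set.range (globalCost f)))
    (hν : 0 < ν) (hPL : PLCondition ν f)
    (hP : Admissible (rho (laplacian A)) (rho2 (laplacian A)) ℓ α β γ τ ω r δ)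
    (h𝒞 : GloballyBounded P 𝒞 r δ C) (hζ : IsCompressionNoise μ P ζ)
    (x0 : Fin n → EuclideanSpace ℝ (Fin d)) (hε : 0 < ε) (hs₀ : 0 < s₀)
    (hq : 1 - α * eps6' (rho (laplacian A)) (rho2 (laplacian A)) ℓ ν α β γ τ ω r δ ≤ q)
    (hεq : ε ^ 2 ≤ q) :
    ∃ a b : NNReal, ∀ k : ℕ,
      ∫⁻ w, ENNReal.ofReal (performance f (run f (laplacian A) α β γ ω (fun k => s₀ * ε ^ k)
        𝒞 x0 (fun i t => ζ i t w) k).x) ∂μ ≤ (a + k * b) * ENNReal.ofReal q ^ k := by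
  have hc : 0 ≤ 1 - 2 * eps9 ω r δ := sub_nonneg.mpr hP.two_mul_eps9_le_one
  refine ⟨(4 / n : ℝ).toNNReal *
      ((State.init x0).energy f A τ γ (1 - 2 * eps9 ω r δ)).toNNReal,
    (4 / n : ℝ).toNNReal * (n * (ω * r * C * s₀ ^ 2).toNNReal), fun k => ?_⟩
  calc _ ≤ ENNReal.ofReal (4 / n) * ∫⁻ w, ENNReal.ofReal ((run f (laplacian A) α β γ ω
          (fun k => s₀ * ε ^ k) 𝒞 x0 (fun i t => ζ i t w) k).energy f A τ γ
            (1 - 2 * eps9 ω r δ)) ∂μ := by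
        rw [← lintegral_const_mul' _ _ ENNReal.ofReal_ne_top]
        refine lintegral_mono fun w => ?_
        rw [← ENNReal.ofReal_mul (by positivity)]
        exact ENNReal.ofReal_le_ofReal
          (State.performance_le_energy hn hA hbdd hP.kappa1_le γ hc _)
    _ ≤ _ := mul_le_mul_right
        (lintegral_energy_run_le hn hA hf hbdd hν hPL hP h𝒞 hζ x0 hε hs₀ hq hεq k) _
    _ = _ := by
        push_cast
        simp only [ENNReal.ofReal]
        ring

lemma measurable_performance_run (hf : ∀ i, IsSmoothWith ℓ (f i))
    (L : Matrix (Fin n) (Fin n) ℝ) (α β γ ω : ℝ) (s : ℕ → ℝ)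
    (h𝒞 : Measurable fun p : Z × EuclideanSpace ℝ (Fin d) => 𝒞 p.1 p.2)
    (hζ : ∀ i t, Measurable (ζ i t)) (x0 : Fin n → EuclideanSpace ℝ (Fin d)) (k : ℕ) :
    Measurable fun a => performance f (run f L α β γ ω s 𝒞 x0 (fun i t => ζ i t a) k).x :=
  (continuous_performance hf).measurable.comp
    (State.measurable_x.comp (measurable_run hf L α β γ ω s h𝒞 x0 fun i t _ => hζ i t))

lemma Admissible.max_rate_mem_Ioo {ρ ρ₂ : ℝ} (hP : Admissible ρ ρ₂ ℓ α β γ τ ω r δ)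
    (hν : 0 < ν) (hε : ε ∈ Set.Ioo (0 : ℝ) 1) :
    max (1 - α * eps6' ρ ρ₂ ℓ ν α β γ τ ω r δ) (ε ^ 2) ∈ Set.Ioo (0 : ℝ) 1 :=
  ⟨lt_max_of_lt_right (pow_pos hε.1 2),
    max_lt (sub_lt_self 1 (mul_pos hP.alpha_pos (hP.eps6_pos hν)))
      (pow_lt_one₀ hε.1.le hε.2 two_ne_zero)⟩

lemma two_mul_le_kappa2 (ρ₂ ℓ : ℝ) : 2 * ℓ ≤ kappa2 ρ₂ ℓ :=
  le_max_of_le_left (le_max_of_le_left (by nlinarith [sq_nonneg (ℓ - 1 / 2)]))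

end Convergence

end UnifiedCompression

end

open UnifiedCompression in
theorem theorem5_general {n d : ℕ} (hn : 2 ≤ n) {A : Matrix (Fin n) (Fin n) ℝ}
    (hA : IsUndirectedConnected A) {f : Fin n → EuclideanSpace ℝ (Fin d) → ℝ}
    {ℓ : ℝ} (hℓ : 0 < ℓ) (hsmooth : ∀ i, IsSmoothWith ℓ (f i))
    (hbdd : BddBelow (Set.range (globalCost f)))
    {ν : ℝ} (hν : 0 < ν) (hPL : PLCondition ν f)
    {Z : Type*} [MeasurableSpace Z] {P : Measure Z} [IsProbabilityMeasure P]
    {𝒞 : Z → EuclideanSpace ℝ (Fin d) → EuclideanSpace ℝ (Fin d)}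
    {r δ C : ℝ} (hr : 0 < r) (hδ : δ ∈ Set.Ioc (0 : ℝ) 1)
    (h𝒞 : GloballyBounded P 𝒞 r δ C)
    {Ω : Type*} [MeasurableSpace Ω] {μ : Measure Ω} [IsProbabilityMeasure μ]
    {ζ : Fin n → ℕ → Ω → Z} (hζ : IsCompressionNoise μ P ζ)
    (x0 : Fin n → EuclideanSpace ℝ (Fin d)) {α β γ τ₁ ω ε s₀ : ℝ}
    (hτ₁ : kappa1 (rho2 (laplacian A)) ≤ τ₁) (hβ : β = τ₁ * γ)
    (hγ : 2 * ℓ ≤ γ) (hω : ω ∈ Set.Ioc (0 : ℝ) (1 / r))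
    (hα : α ∈ Set.Ioo (0 : ℝ) (kappa0' (rho (laplacian A)) (rho2 (laplacian A)) ℓ β γ ω r δ))
    (hε : ε ∈ Set.Ioo (0 : ℝ) 1) (hs₀ : 0 < s₀)
    {x : ℕ → Ω → Fin n → EuclideanSpace ℝ (Fin d)}
    (hx : ∀ k a, x k a = (run f (laplacian A) α β γ ω (fun k => s₀ * ε ^ k) 𝒞 x0
      (fun i t => ζ i t a) k).x)
    {ε₀ : ℝ} (hε₀ : ε₀ = max
      (1 - α * eps6' (rho (laplacian A)) (rho2 (laplacian A)) ℓ ν α β γ τ₁ ω r δ) (ε ^ 2)) :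
    ε₀ ∈ Set.Ioo (0 : ℝ) 1 ∧
    (∀ k, Integrable (fun a => performance f (x k a)) μ) ∧
    ∀ ε' ∈ Set.Ioo ε₀ 1,
      (fun k : ℕ => ∫ a, performance f (x k a) ∂μ) =O[atTop] (fun k : ℕ => ε' ^ k) := by
  obtain rfl : x = fun k a => (run f (laplacian A) α β γ ω (fun k => s₀ * ε ^ k) 𝒞 x0
    (fun i t => ζ i t a) k).x := funext₂ hx
  have hP : Admissible (rho (laplacian A)) (rho2 (laplacian A)) ℓ α β γ τ₁ ω r δ :=
    ⟨rho2_laplacian_pos hn hA, rho2_le_rho_laplacian hn hA, hℓ, hγ, hτ₁, hβ, hr, hδ, hω, hα⟩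
  have hε₀_mem : ε₀ ∈ Set.Ioo (0 : ℝ) 1 := hε₀ ▸ hP.max_rate_mem_Ioo hν hε
  obtain ⟨a, b, hab⟩ := exists_lintegral_performance_run_le hn hA hsmooth hbdd hν hPL hP h𝒞 hζ x0
    hε.1 hs₀ (hε₀ ▸ le_max_left _ _) (hε₀ ▸ le_max_right _ _)
  obtain ⟨hint, hO⟩ := integrable_and_isBigO_pow_of_lintegral_le
    (fun k => (measurable_performance_run hsmooth _ α β γ ω _ h𝒞.measurable
      (fun i t => (hζ.law i t).measurable) x0 k).aestronglyMeasurable)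
    (fun _ _ => performance_nonneg hbdd _) hε₀_mem.1.le hab
  exact ⟨hε₀_mem, hint, fun ε' hε' => hO ε' hε'.1⟩

theorem theorem5 {n d : ℕ} (hn : 2 ≤ n)
    -- communication network
    (A : Matrix (Fin n) (Fin n) ℝ) (hA : UnifiedCompression.IsUndirectedConnected A)
    (L : Matrix (Fin n) (Fin n) ℝ) (hL : L = UnifiedCompression.laplacian A)
    (ρ ρ₂ : ℝ) (hρ : ρ = UnifiedCompression.rho L) (hρ₂ : ρ₂ = UnifiedCompression.rho2 L)
    -- cost functions
    (f : Fin n → EuclideanSpace ℝ (Fin d) → ℝ)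
    (ℓ : ℝ) (hℓ : 0 < ℓ) (hsmooth : ∀ i, UnifiedCompression.IsSmoothWith ℓ (f i))
    (hbdd : BddBelow (Set.range (UnifiedCompression.globalCost f)))
    (ν : ℝ) (hν : 0 < ν) (hPL : UnifiedCompression.PLCondition ν f)
    -- compressor and its internal randomness
    {Z : Type*} [MeasurableSpace Z] (P : Measure Z) [IsProbabilityMeasure P]
    (𝒞 : Z → EuclideanSpace ℝ (Fin d) → EuclideanSpace ℝ (Fin d))
    (r δ C : ℝ) (hr : 0 < r) (hδ : δ ∈ Set.Ioc (0 : ℝ) 1) (hC : 0 < C)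
    (h𝒞 : UnifiedCompression.GloballyBounded P 𝒞 r δ C)
    {Ω : Type*} [MeasurableSpace Ω] (μ : Measure Ω) [IsProbabilityMeasure μ]
    (ζ : Fin n → ℕ → Ω → Z) (hζ : UnifiedCompression.IsCompressionNoise μ P ζ)
    -- parameters of the algorithm
    (x0 : Fin n → EuclideanSpace ℝ (Fin d))
    (α β γ τ₁ ω ε s₀ : ℝ)
    (hτ₁ : UnifiedCompression.kappa1 ρ₂ ≤ τ₁) (hβ : β = τ₁ * γ)
    (hγ : UnifiedCompression.kappa2 ρ₂ ℓ < γ) (hω : ω ∈ Set.Ioc (0 : ℝ) (1 / r))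
    (hα : α ∈ Set.Ioo (0 : ℝ) (UnifiedCompression.kappa0' ρ ρ₂ ℓ β γ ω r δ))
    (hε : ε ∈ Set.Ioo (0 : ℝ) 1)
    (p : ENNReal) [Fact (1 ≤ p)] (hs₀ : 0 < s₀) (hx0 : ∀ i, ‖WithLp.toLp p (x0 i).ofLp‖ ≤ s₀)
    -- the iterates
    (x : ℕ → Ω → Fin n → EuclideanSpace ℝ (Fin d))
    (hx : ∀ k a, x k a = (UnifiedCompression.run f L α β γ ω (fun k => s₀ * ε ^ k) 𝒞 x0
      (fun i t => ζ i t a) k).x)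
    -- the lower end of the range of rates
    (ε₀ : ℝ) (hε₀ : ε₀ = max
      (1 - α * UnifiedCompression.eps6' ρ ρ₂ ℓ ν α β γ τ₁ ω r δ) (ε ^ 2)) :
    ε₀ ∈ Set.Ioo (0 : ℝ) 1 ∧
    (∀ k, Integrable (fun a => UnifiedCompression.performance f (x k a)) μ) ∧
    ∀ ε' ∈ Set.Ioo ε₀ 1,
      (fun k : ℕ => ∫ a, UnifiedCompression.performance f (x k a) ∂μ)
        =O[atTop] (fun k : ℕ => ε' ^ k) := by
  subst hL hρ hρ₂
  exact theorem5_general hn hA hℓ hsmooth hbdd hν hPL hr hδ h𝒞 hζ x0 hτ₁ hβ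
    ((UnifiedCompression.two_mul_le_kappa2 _ ℓ).trans hγ.le) hω hα hε hs₀ hx hε₀
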